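/- Let $L^3$ be $\mathbb R^3$ with the scalar product $\langle X,Y\rangle=X_1Y_1+X_2Y_2-X_3Y_3$, and let $S_1^3$ be represented by the upper half-space $\{x_3>0\}$ with the Lorentz metric $x_3^{-2}(dx_1^2+dx_2^2-dx_3^2)$. It is a Lie group with identity $e=(0,0,1)$ and product $(x_1,x_2,x_3)\cdot(y_1,y_2,y_3)=(x_1+x_3y_1,\;x_2+x_3y_2,\;x_3y_3)$. For a smooth space-like immersed surface $x$ in $S_1^3$ with smooth time-like unit normal field $N$ and second fundamental form $\mathrm{II}$, the normal Gauss map is $\widetilde N=(L_{x^{-1}})_*N\in T_eS_1^3\cong L^3$ (here $\widetilde N=N/x_3$), and the fourth fundamental form is $\mathrm{IV}=\langle d\widetilde N,d\widetilde N\rangle$. The normal Gauss map is called conformal if $\mathrm{IV}=\rho\,\mathrm{II}$ for some smooth real function $\rho$ on the surface. THEOREM 6.2. Let $D\subseteq\mathbb R^2$ be open and let $x(u,v)=\alpha(v)+u\beta(v)$, $(u,v)\in D$, with smooth $L^3$-valued $\alpha,\beta$, be a space-like (ruled) immersed surface in $S_1^3$ whose normal Gauss map is conformal. Then for every point of $D$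 there are a neighbourhood $U\subseteq D$ of the point and real numbers $\theta,a,b$ such that, after applying the isometry $$(x_1,x_2,x_3)\mapsto(x_1\cos\theta-x_2\sin\theta+a,\;x_1\sin\theta+x_2\cos\theta+b,\;x_3)\qquad(6.5)$$ of $S_1^3$, the surface $x|_U$ is, up to a smooth change of parameters (a diffeomorphism of $U$ onto an open set of parameters), a part of one of the following surfaces: (1) a Euclidean affine plane on which $\langle\cdot,\cdot\rangle$ is positive definite; (2) $(u\cosh v,\;c\sinh v,\;u\sinh v)$ for a constant $c\neq0$; (3) $(c_2\sinh v+u\cosh v,\;c_1\sinh v,\;c_2\cosh v+u\sinh v)$ for constants $c_1\neq0$ and $c_2\neq0$. -/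

import Mathlib

open scoped ContDiff

noncomputable section

namespace DeSitter

/-- The underlying vector space of Minkowski 3-space; the coordinates `x₁, x₂, x₃` are
the entries `0, 1, 2`. -/
abbrev L3 : Type := Fin 3 → ℝ

/-- The Lorentz-Minkowski scalar product `X₁Y₁ + X₂Y₂ - X₃Y₃`. -/
def mink (X Y : L3) : ℝ := X 0 * Y 0 + X 1 * Y 1 - X 2 * Y 2

/-- The upper half-space `x₃ > 0`, the underlying set of the model of `S₁³`. -/
def upperHalfSpace : Set L3 := {p | 0 < p 2}

/-- The Lorentz metric `(dx₁² + dx₂² - dx₃²) / x₃²` of `S₁³` at the point `p`. -/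
def metric (p X Y : L3) : ℝ := mink X Y / p 2 ^ 2

/-- The coefficient matrix of the metric of `S₁³` at `p`. -/
def metricMatrix (p : L3) : Matrix (Fin 3) (Fin 3) ℝ :=
  fun i j => metric p (Pi.single i 1) (Pi.single j 1)

/-- The partial derivative `∂f/∂xᵢ` at `p`. -/
def partialDeriv (i : Fin 3) (f : L3 → ℝ) (p : L3) : ℝ := fderiv ℝ f p (Pi.single i 1)

/-- The Christoffel symbols `Γᵏᵢⱼ = ½ ∑ₗ gᵏˡ (∂ᵢ gⱼₗ + ∂ⱼ gᵢₗ - ∂ₗ gᵢⱼ)` of the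
Levi-Civita connection of `S₁³` at `p`. -/
def christoffel (p : L3) (k i j : Fin 3) : ℝ :=
  (1 / 2) * ∑ l : Fin 3, (metricMatrix p)⁻¹ k l *
    (partialDeriv i (fun y => metricMatrix y j l) p
      + partialDeriv j (fun y => metricMatrix y i l) p
      - partialDeriv l (fun y => metricMatrix y i j) p)

/-- The covariant derivative at `q`, in the direction `w`, of a vector field `V` along the map
`x` into `S₁³`. -/
def covDeriv (x V : ℝ × ℝ → L3) (q w : ℝ × ℝ) : L3 :=
  fun k => fderiv ℝ V q w k
    + ∑ i : Fin 3, ∑ j : Fin 3, christoffel (x q) k i j * fderiv ℝ x q w i * V q j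

/-- `x` is a smooth space-like immersion of `D` into (the upper half-space model of) `S₁³`:
the first fundamental form is positive definite. -/
structure IsSpacelikeImmersion (x : ℝ × ℝ → L3) (D : Set (ℝ × ℝ)) : Prop where
  smooth : ContDiffOn ℝ ∞ x D
  mapsTo : Set.MapsTo x D upperHalfSpace
  pos : ∀ q ∈ D, ∀ w : ℝ × ℝ, w ≠ 0 → 0 < metric (x q) (fderiv ℝ x q w) (fderiv ℝ x q w)

/-- `N` is a smooth time-like unit normal vector field along `x` on `D`. -/
structure IsUnitNormal (x N : ℝ × ℝ → L3) (D : Set (ℝ × ℝ)) : Prop where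
  smooth : ContDiffOn ℝ ∞ N D
  unit : ∀ q ∈ D, metric (x q) (N q) (N q) = -1
  normal : ∀ q ∈ D, ∀ w : ℝ × ℝ, metric (x q) (N q) (fderiv ℝ x q w) = 0

/-- The second fundamental form `II(w, w') = ⟨∇_w N, dx(w')⟩ = -⟨N, ∇_w dx(w')⟩`. -/
def secondForm (x N : ℝ × ℝ → L3) (q w w' : ℝ × ℝ) : ℝ :=
  metric (x q) (covDeriv x N q w) (fderiv ℝ x q w')

/-- The Lie group structure of `S₁³`, with identity `e = (0, 0, 1)`: the point `p` stands for
the matrix with rows `(1, 0, 0, log p₃)`, `(0, p₃, 0, p₁)`, `(0, 0, p₃, p₂)`, `(0, 0, 0, 1)`,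
and the product is the matrix product. -/
def gmul (p y : L3) : L3 := ![p 0 + p 2 * y 0, p 1 + p 2 * y 1, p 2 * y 2]

/-- The inverse in the Lie group `S₁³`. -/
def ginv (p : L3) : L3 := ![-p 0 / p 2, -p 1 / p 2, 1 / p 2]

/-- The normal Gauss map: the unit normal at `x q`, left translated to the tangent space at the
identity. -/
def normalGaussMap (x N : ℝ × ℝ → L3) (q : ℝ × ℝ) : L3 :=
  fderiv ℝ (gmul (ginv (x q))) (x q) (N q)

/-- The fourth fundamental form, the pull-back of the Minkowski scalar product by the normal
Gauss map. -/
def fourthForm (x N : ℝ × ℝ → L3) (q w w' : ℝ × ℝ) : ℝ :=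
  mink (fderiv ℝ (normalGaussMap x N) q w) (fderiv ℝ (normalGaussMap x N) q w')

/-- The normal Gauss map of `x` on `D` is conformal: `IV = ρ II` for a smooth function `ρ`. -/
def HasConformalNormalGaussMap (x : ℝ × ℝ → L3) (D : Set (ℝ × ℝ)) : Prop :=
  ∃ N : ℝ × ℝ → L3, IsUnitNormal x N D ∧
    ∃ ρ : ℝ × ℝ → ℝ, ContDiffOn ℝ ∞ ρ D ∧
      ∀ q ∈ D, ∀ w w' : ℝ × ℝ, fourthForm x N q w w' = ρ q * secondForm x N q w w'

/-- The ruled surface `x(u, v) = α(v) + u β(v)`. -/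
def ruled (α β : ℝ → L3) (q : ℝ × ℝ) : L3 := α q.2 + q.1 • β q.2

/-- The isometry of `S₁³` that rotates the `(x₁, x₂)`-plane by `θ` and translates it
by `(a, b)`. -/
def rotTrans (θ a b : ℝ) (p : L3) : L3 :=
  ![p 0 * Real.cos θ - p 1 * Real.sin θ + a, p 0 * Real.sin θ + p 1 * Real.cos θ + b, p 2]

/-- Near `p`, the parametrized surface `x : D → S₁³` is a part of the parametrized surface `S`:
on a neighbourhood of `p` in `D` it is the composition of `S` with a smooth change of
parameters. -/
def IsPartOfNear (x : ℝ × ℝ → L3) (D : Set (ℝ × ℝ)) (p : ℝ × ℝ) (S : ℝ × ℝ → L3) : Prop :=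
  ∃ φ : OpenPartialHomeomorph (ℝ × ℝ) (ℝ × ℝ), p ∈ φ.source ∧ φ.source ⊆ D ∧
    ContDiffOn ℝ ∞ φ φ.source ∧ ContDiffOn ℝ ∞ φ.symm φ.target ∧
      ∀ q ∈ φ.source, x q = S (φ q)

/-- The affine plane through `P` spanned by `A` and `B`. -/
def plane (P A B : L3) (q : ℝ × ℝ) : L3 := P + q.1 • A + q.2 • B

/-- The vectors `A` and `B` span a space-like plane. -/
def SpanSpacelike (A B : L3) : Prop :=
  ∀ s t : ℝ, (s, t) ≠ (0, 0) → 0 < mink (s • A + t • B) (s • A + t • B)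

/-- The surface `(u cosh v, c sinh v, u sinh v)`. -/
def surfaceTwo (c : ℝ) (q : ℝ × ℝ) : L3 :=
  ![q.1 * Real.cosh q.2, c * Real.sinh q.2, q.1 * Real.sinh q.2]

/-- The surface `(c₂ sinh v + u cosh v, c₁ sinh v, c₂ cosh v + u sinh v)`. -/
def surfaceThree (c₁ c₂ : ℝ) (q : ℝ × ℝ) : L3 :=
  ![c₂ * Real.sinh q.2 + q.1 * Real.cosh q.2, c₁ * Real.sinh q.2,
    c₂ * Real.cosh q.2 + q.1 * Real.sinh q.2]

end DeSitter

end

open scoped ContDiff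

/-! ### The Levi-Civita connection and the fundamental forms in Minkowski terms -/

namespace DeSitter

/-! Left translation by `x⁻¹` scales tangent vectors by `1 / x₃`. Hence the normal Gauss map `n` is
a unit normal for the flat Minkowski product, IV is the Minkowski third fundamental form, and II is
a combination of `⟨dn, dx⟩` and `n₃⟨dx, dx⟩` (`secondForm_eq`). Rulings are asymptotic for `⟨dn,
dx⟩`, so conformality implies one scalar relation between the product and the sum of the Minkowski
principal curvatures (`curvature_relation_of_mink`).

The rulings are space-like, so after a rotation the surface is locally `(u, a + u y, h + u g)` with
`a, y, g, h` functions of `v` and `y = 0` at the given ruling. The relation becomes a cubic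
polynomial in `u`, and all its coefficients vanish. Put `Δ = a'g' - h'y'`; up to a nonzero factor
this is the mixed coefficient `⟨n_u, x_v⟩`, so `Δ = 0` means flatness along the ruling. Evaluating
the cubic at the root of `a' + u y'` shows that `y' ≠ 0` forces `Δ = 0`
(`IsConformalGraph.disc_eq_zero`).

If `Δ = 0` at the given ruling, a conserved quantity extends this to nearby rulings, and the slope
`(h' + u g') / (a' + u y')` is then constant: the surface lies in a plane. If `Δ ≠ 0`, then `y = 0`
nearby, and the two remaining equations say that `g / √(1 - g²)` and `h / √(1 - g²)` are affine
functions of `a`. Setting the first equal to `sinh` of a new parameter gives surface (3), or (2)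
when `c₂ = 0`. -/

theorem normalGaussMap_eq (x N : ℝ × ℝ → L3) (q : ℝ × ℝ) :
    normalGaussMap x N q = (x q 2)⁻¹ • N q := by
  have h : ∀ p y : L3, HasFDerivAt (gmul (ginv p))
      ((p 2)⁻¹ • ContinuousLinearMap.id ℝ L3) y := by
    intro p y
    have e : gmul (ginv p) = fun y : L3 => ![-p 0 / p 2, -p 1 / p 2, 0] + (p 2)⁻¹ • y := by
      funext y i
      fin_cases i <;> simp [gmul, ginv]
    rw [e]
    exact ((hasFDerivAt_id (𝕜 := ℝ) y).const_smul (p 2)⁻¹).const_add _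
  rw [normalGaussMap, (h _ _).fderiv]
  simp

/-- The diagonal of the Minkowski scalar product. -/
noncomputable def minkDiag : Fin 3 → ℝ := ![1, 1, -1]

theorem metricMatrix_eq (p : L3) (i j : Fin 3) :
    metricMatrix p i j = (if i = j then minkDiag i else 0) / p 2 ^ 2 := by
  rw [metricMatrix, metric]
  congr 1
  fin_cases i <;> fin_cases j <;> simp [mink, minkDiag]

theorem metricMatrix_inv {p : L3} (hp : p 2 ≠ 0) (i j : Fin 3) :
    (metricMatrix p)⁻¹ i j = (if i = j then minkDiag i else 0) * p 2 ^ 2 := by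
  have : (metricMatrix p)⁻¹ =
      Matrix.of fun i j => (if i = j then minkDiag i else 0) * p 2 ^ 2 := by
    apply Matrix.inv_eq_right_inv
    ext i j
    rw [Matrix.mul_apply]
    simp only [metricMatrix_eq, Fin.sum_univ_three, Matrix.of_apply]
    fin_cases i <;> fin_cases j <;> simp [minkDiag] <;> field_simp
  rw [this, Matrix.of_apply]

theorem partialDeriv_metricMatrix {p : L3} (hp : p 2 ≠ 0) (l i j : Fin 3) :
    partialDeriv l (fun y => metricMatrix y i j) p =
      (if i = j then minkDiag i else 0) * (if l = 2 then -2 / p 2 ^ 3 else 0) := by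
  simp only [metricMatrix_eq, partialDeriv]
  set c : ℝ := if i = j then minkDiag i else 0
  have h1 : HasFDerivAt (fun y : L3 => y 2)
      (ContinuousLinearMap.proj (R := ℝ) (φ := fun _ : Fin 3 => ℝ) 2) p :=
    (ContinuousLinearMap.proj (R := ℝ) (φ := fun _ : Fin 3 => ℝ) 2).hasFDerivAt
  have h2 : HasDerivAt (fun t : ℝ => c / t ^ 2) (c * (-2 / p 2 ^ 3)) (p 2) := by
    have := ((hasDerivAt_pow 2 (p 2)).inv (pow_ne_zero 2 hp)).const_mul c
    refine (this.congr_deriv ?_).congr_of_eventuallyEq ?_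
    · field_simp
      push_cast
      ring
    · exact Filter.Eventually.of_forall fun t => by simp [div_eq_mul_inv]
  have h3 := h2.comp_hasFDerivAt p h1
  have h4 : HasFDerivAt (fun y : L3 => c / y 2 ^ 2)
      ((c * (-2 / p 2 ^ 3)) • ContinuousLinearMap.proj (R := ℝ) (φ := fun _ : Fin 3 => ℝ) 2) p :=
    h3
  rw [h4.fderiv]
  fin_cases l <;> simp

theorem christoffel_eq {p : L3} (hp : p 2 ≠ 0) (k i j : Fin 3) :
    christoffel p k i j = -(1 / p 2) * ((if i = 2 then 1 else 0) * (if j = k then 1 else 0)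
      + (if j = 2 then 1 else 0) * (if i = k then 1 else 0)
      + (if k = 2 then 1 else 0) * (if i = j then minkDiag i else 0)) := by
  simp only [christoffel, Fin.sum_univ_three, metricMatrix_inv hp, partialDeriv_metricMatrix hp]
  fin_cases k <;> fin_cases i <;> fin_cases j <;> simp [minkDiag] <;> field_simp

theorem covDeriv_eq {x V : ℝ × ℝ → L3} {q w : ℝ × ℝ} (hq : x q 2 ≠ 0) :
    covDeriv x V q w = fderiv ℝ V q w - (x q 2)⁻¹ • (fderiv ℝ x q w 2 • V q
      + V q 2 • fderiv ℝ x q w + mink (fderiv ℝ x q w) (V q) • Pi.single 2 1) := by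
  funext k
  simp only [covDeriv, christoffel_eq hq, Fin.sum_univ_three, mink]
  fin_cases k <;> simp [minkDiag] <;> ring

/-- Put `N = x₃ n` in the covariant derivative: every term proportional to `N`, and the term with
`⟨dx, N⟩`, dies by orthogonality. Only the term `N₃ dx` of the connection survives. -/
theorem secondForm_eq {x N : ℝ × ℝ → L3} {q : ℝ × ℝ} (hx : 0 < x q 2)
    (hn : ∀ w, mink (N q) (fderiv ℝ x q w) = 0) (hxd : DifferentiableAt ℝ x q)
    (hNd : DifferentiableAt ℝ N q) (w w' : ℝ × ℝ) :
    secondForm x N q w w' =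
      mink (fderiv ℝ (normalGaussMap x N) q w) (fderiv ℝ x q w') / x q 2
        - normalGaussMap x N q 2 * mink (fderiv ℝ x q w) (fderiv ℝ x q w') / x q 2 ^ 2 := by
  have hx2 : HasFDerivAt (fun q => x q 2)
      ((ContinuousLinearMap.proj (R := ℝ) (φ := fun _ : Fin 3 => ℝ) 2).comp (fderiv ℝ x q)) q :=
    (ContinuousLinearMap.proj (R := ℝ) (φ := fun _ : Fin 3 => ℝ) 2).hasFDerivAt.comp q
      hxd.hasFDerivAt
  have hinv := (hasDerivAt_inv hx.ne').comp_hasFDerivAt q hx2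
  have hG : HasFDerivAt (normalGaussMap x N) _ q :=
    (hinv.smul hNd.hasFDerivAt).congr_of_eventuallyEq
      (Filter.Eventually.of_forall (normalGaussMap_eq x N))
  rw [hG.fderiv, secondForm, covDeriv_eq hx.ne', normalGaussMap_eq, metric]
  have h1 := hn w
  have h2 := hn w'
  set a := fderiv ℝ x q w
  set b := fderiv ℝ x q w'
  set c := fderiv ℝ N q w with hc
  simp only [mink] at h1 h2 ⊢
  simp
  rw [← hc]
  have hx' := hx.ne'
  field_simp
  linear_combination (b 2) * h1

/-! ### Minkowski linear algebra and the relation between the principal curvatures -/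

theorem timelike_two_ne_zero {n : L3} (hnn : mink n n = -1) : n 2 ≠ 0 := by
  intro h
  simp only [mink, h] at hnn
  nlinarith [sq_nonneg (n 0), sq_nonneg (n 1)]

/-- The square of `d = det(n, X, Y)` is minus the Gram determinant, hence positive, so `n, X, Y` is
a basis; Cramer's rule gives `d • Z = 0`. -/
theorem eq_zero_of_mink_eq_zero {n X Y Z : L3} (hnn : mink n n = -1) (hnX : mink n X = 0)
    (hnY : mink n Y = 0) (hW : 0 < mink X X * mink Y Y - mink X Y ^ 2)
    (hn : mink n Z = 0) (hX : mink X Z = 0) (hY : mink Y Z = 0) : Z = 0 := by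
  set d := n 0 * (X 1 * Y 2 - X 2 * Y 1) + n 1 * (X 2 * Y 0 - X 0 * Y 2)
    + n 2 * (X 0 * Y 1 - X 1 * Y 0) with hd
  have hd2 : d ^ 2 = -(mink n n * (mink X X * mink Y Y - mink X Y ^ 2)
      - mink n X * (mink n X * mink Y Y - mink X Y * mink n Y)
      + mink n Y * (mink n X * mink X Y - mink X X * mink n Y)) := by
    simp only [hd, mink]; ring
  rw [hnn, hnX, hnY] at hd2
  have hd0 : d ≠ 0 := by
    intro h
    rw [h] at hd2
    linarith
  simp only [mink] at hn hX hY
  have h0 : d * Z 0 = 0 := by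
    linear_combination (X 1 * Y 2 - X 2 * Y 1) * hn + (Y 1 * n 2 - Y 2 * n 1) * hX
      + (n 1 * X 2 - n 2 * X 1) * hY
  have h1 : d * Z 1 = 0 := by
    linear_combination (X 2 * Y 0 - X 0 * Y 2) * hn + (Y 2 * n 0 - Y 0 * n 2) * hX
      + (n 2 * X 0 - n 0 * X 2) * hY
  have h2 : d * Z 2 = 0 := by
    linear_combination -(X 0 * Y 1 - X 1 * Y 0) * hn - (Y 0 * n 1 - Y 1 * n 0) * hX
      - (n 0 * X 1 - n 1 * X 0) * hY
  funext i
  fin_cases i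
  · exact (mul_eq_zero.1 h0).resolve_left hd0
  · exact (mul_eq_zero.1 h1).resolve_left hd0
  · exact (mul_eq_zero.1 h2).resolve_left hd0

/-- A conformal normal Gauss map makes the product of the principal curvatures proportional to
their sum, provided that some direction is asymptotic. -/
theorem curvature_relation {E F G M N W x n ρ : ℝ} (hE : 0 < E) (hW : W ≠ 0) (hx : x ≠ 0)
    (hn : n ≠ 0) (h1 : E * M ^ 2 = W * (ρ * (0 / x - n * E / x ^ 2)))
    (h2 : M * (E * N - F * M) = W * (ρ * (M / x - n * F / x ^ 2)))
    (h3 : G * M ^ 2 - 2 * F * M * N + E * N ^ 2 = W * (ρ * (N / x - n * G / x ^ 2))) :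
    x * M ^ 2 + n * (E * N - 2 * F * M) = 0 := by
  have e1 : M ^ 2 * x ^ 2 = -(W * ρ * n) := by
    apply mul_left_cancel₀ hE.ne'
    field_simp at h1
    linear_combination h1
  have e2 : M * ((E * N - 2 * F * M) * x - W * ρ) = 0 := by
    field_simp at h2
    apply mul_left_cancel₀ hx
    linear_combination h2 - F * e1
  -- If `M = 0`, then `ρ = 0` by `e1` and `N = 0` by `h3`. Otherwise `ρ` is eliminated between `e1`
  -- and `hM`.
  rcases mul_eq_zero.1 e2 with hM | hM
  · subst hM
    have hρ : ρ = 0 := by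
      by_contra h
      exact mul_ne_zero (mul_ne_zero hW h) hn (by linear_combination e1)
    subst hρ
    have : E * N ^ 2 = 0 := by linear_combination h3
    have hN : N = 0 := by
      rcases mul_eq_zero.1 this with h | h
      · exact absurd h hE.ne'
      · exact pow_eq_zero_iff (two_ne_zero) |>.1 h
    subst hN; ring
  · apply mul_left_cancel₀ hx
    linear_combination n * hM + e1

/-- The relation of `curvature_relation`, where `A` and `B` are the derivatives of the normal `n`
in the tangent directions `X` and `Y`. -/
theorem curvature_relation_of_mink {n X Y A B : L3} {x ρ : ℝ} (hnn : mink n n = -1)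
    (hnX : mink n X = 0) (hnY : mink n Y = 0) (hE : 0 < mink X X)
    (hW : 0 < mink X X * mink Y Y - mink X Y ^ 2) (hx : x ≠ 0)
    (hnA : mink n A = 0) (hnB : mink n B = 0) (hAX : mink A X = 0) (hsym : mink B X = mink A Y)
    (hAA : mink A A = ρ * (mink A X / x - n 2 * mink X X / x ^ 2))
    (hAB : mink A B = ρ * (mink A Y / x - n 2 * mink X Y / x ^ 2))
    (hBB : mink B B = ρ * (mink B Y / x - n 2 * mink Y Y / x ^ 2)) :
    x * mink A Y ^ 2 + n 2 * (mink X X * mink B Y - 2 * mink X Y * mink A Y) = 0 := by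
  obtain ⟨E, hE'⟩ : ∃ E, E = mink X X := ⟨_, rfl⟩
  obtain ⟨F, hF'⟩ : ∃ F, F = mink X Y := ⟨_, rfl⟩
  obtain ⟨G, hG'⟩ : ∃ G, G = mink Y Y := ⟨_, rfl⟩
  obtain ⟨M, hM'⟩ : ∃ M, M = mink A Y := ⟨_, rfl⟩
  obtain ⟨N, hN'⟩ : ∃ N, N = mink B Y := ⟨_, rfl⟩
  -- The Weingarten equations with vanishing first coefficient, checked by pairing with `n`, `X` and
  -- `Y`.
  have hA : (E * G - F ^ 2) • A - (M * E) • Y + (M * F) • X = 0 := by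
    apply eq_zero_of_mink_eq_zero hnn hnX hnY hW
    · simp only [mink, Pi.add_apply, Pi.sub_apply, Pi.smul_apply, smul_eq_mul] at *
      linear_combination (E * G - F ^ 2) * hnA - (M * E) * hnY + M * F * hnX
    · simp only [mink, Pi.add_apply, Pi.sub_apply, Pi.smul_apply, smul_eq_mul] at *
      linear_combination (E * G - F ^ 2) * hAX + (M * E) * hF' - M * F * hE'
    · simp only [mink, Pi.add_apply, Pi.sub_apply, Pi.smul_apply, smul_eq_mul] at *
      linear_combination -(E * G - F ^ 2) * hM' + (M * E) * hG' - M * F * hF'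
  have hB : (E * G - F ^ 2) • B - (G * M - F * N) • X - (E * N - F * M) • Y = 0 := by
    apply eq_zero_of_mink_eq_zero hnn hnX hnY hW
    · simp only [mink, Pi.sub_apply, Pi.smul_apply, smul_eq_mul] at *
      linear_combination (E * G - F ^ 2) * hnB - (G * M - F * N) * hnX - (E * N - F * M) * hnY
    · simp only [mink, Pi.sub_apply, Pi.smul_apply, smul_eq_mul] at *
      linear_combination (E * G - F ^ 2) * (hsym - hM') + (G * M - F * N) * hE'
        + (E * N - F * M) * hF'
    · simp only [mink, Pi.sub_apply, Pi.smul_apply, smul_eq_mul] at *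
      linear_combination -(E * G - F ^ 2) * hN' + (G * M - F * N) * hF' + (E * N - F * M) * hG'
  have cA : ∀ i, (E * G - F ^ 2) * A i = (M * E) * Y i - (M * F) * X i := fun i => by
    have := congrFun hA i
    simp at this
    linarith
  have cB : ∀ i, (E * G - F ^ 2) * B i = (G * M - F * N) * X i + (E * N - F * M) * Y i :=
    fun i => by
      have := congrFun hB i
      simp at this
      linarith
  rw [hAX] at hAA
  have hn2 : n 2 ≠ 0 := timelike_two_ne_zero hnn
  refine curvature_relation (ρ := ρ) (G := mink Y Y) hE hW.ne' hx hn2 ?_ ?_ ?_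
  · rw [← hAA, ← hE', ← hF', ← hG', ← hM']
    simp only [mink] at hM' hAX ⊢
    linear_combination M * E * hM' - A 0 * cA 0 - A 1 * cA 1 + A 2 * cA 2 + M * F * hAX
  · rw [← hAB, ← hE', ← hF', ← hG', ← hM', ← hN']
    simp only [mink] at hM' hAX ⊢
    linear_combination (E * N - F * M) * hM' - A 0 * cB 0 - A 1 * cB 1 + A 2 * cB 2
      - (G * M - F * N) * hAX
  · rw [← hBB, ← hE', ← hF', ← hG', ← hM', ← hN']
    simp only [mink] at hM' hN' hsym ⊢
    linear_combination (E * N - F * M) * hN' - B 0 * cB 0 - B 1 * cB 1 + B 2 * cB 2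
      - (G * M - F * N) * (hsym - hM')

/-! ### Ruled surfaces as graphs and their conformality equation -/

/-- The ruled surface whose ruling through the parameter `v` meets the plane `x₁ = 0` in
`(0, a v, h v)` and has the direction `(1, y v, g v)`. -/
def graphRuled (a y g h : ℝ → ℝ) (q : ℝ × ℝ) : L3 :=
  ![q.1, a q.2 + q.1 * y q.2, h q.2 + q.1 * g q.2]

theorem hasFDerivAt_comp_snd {f : ℝ → ℝ} {f' : ℝ} {q : ℝ × ℝ} (hf : HasDerivAt f f' q.2) :
    HasFDerivAt (fun q : ℝ × ℝ => f q.2) (f' • ContinuousLinearMap.snd ℝ ℝ ℝ) q :=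
  hf.comp_hasFDerivAt q hasFDerivAt_snd

theorem hasFDerivAt_add_fst_mul {f k : ℝ → ℝ} {f' k' : ℝ} {q : ℝ × ℝ}
    (hf : HasDerivAt f f' q.2) (hk : HasDerivAt k k' q.2) :
    HasFDerivAt (fun q : ℝ × ℝ => f q.2 + q.1 * k q.2)
      ((f' + q.1 * k') • ContinuousLinearMap.snd ℝ ℝ ℝ
        + k q.2 • ContinuousLinearMap.fst ℝ ℝ ℝ) q := by
  have := (hasFDerivAt_comp_snd hf).add ((hasFDerivAt_fst (𝕜 := ℝ) (p := q)).mul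
    (hasFDerivAt_comp_snd hk))
  refine this.congr_fderiv ?_
  ext <;> simp

theorem fderiv_graphRuled {a y g h : ℝ → ℝ} {q : ℝ × ℝ} (ha : DifferentiableAt ℝ a q.2)
    (hy : DifferentiableAt ℝ y q.2) (hg : DifferentiableAt ℝ g q.2)
    (hh : DifferentiableAt ℝ h q.2) (w : ℝ × ℝ) :
    fderiv ℝ (graphRuled a y g h) q w =
      ![w.1, w.1 * y q.2 + w.2 * (deriv a q.2 + q.1 * deriv y q.2),
        w.1 * g q.2 + w.2 * (deriv h q.2 + q.1 * deriv g q.2)] := by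
  have h1 := hasFDerivAt_add_fst_mul ha.hasDerivAt hy.hasDerivAt
  have h2 := hasFDerivAt_add_fst_mul hh.hasDerivAt hg.hasDerivAt
  have : HasFDerivAt (graphRuled a y g h) (ContinuousLinearMap.pi
      ![ContinuousLinearMap.fst ℝ ℝ ℝ,
        (deriv a q.2 + q.1 * deriv y q.2) • ContinuousLinearMap.snd ℝ ℝ ℝ
          + y q.2 • ContinuousLinearMap.fst ℝ ℝ ℝ,
        (deriv h q.2 + q.1 * deriv g q.2) • ContinuousLinearMap.snd ℝ ℝ ℝ
          + g q.2 • ContinuousLinearMap.fst ℝ ℝ ℝ]) q := by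
    rw [hasFDerivAt_pi']
    intro i
    fin_cases i
    · exact hasFDerivAt_fst
    · exact h1
    · exact h2
  rw [this.fderiv]
  funext i
  fin_cases i <;> simp <;> ring

/-- `curvature_relation_of_mink` for the tangent vectors `(1, y, g)` and `(0, c, k)`, where
`(0, p, r)` is the second derivative along the second parameter. -/
theorem graph_curvature_relation {n1 n2 x y g c k y' g' p r : ℝ} (hn2 : n2 ≠ 0) (hc : c ≠ 0)
    (hY : n1 * c - n2 * k = 0)
    (rel : x * (-(n1 * y' - n2 * g')) ^ 2 + n2 * ((1 + y ^ 2 - g ^ 2) * -(n1 * p - n2 * r)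
      - 2 * (y * c - g * k) * -(n1 * y' - n2 * g')) = 0) :
    x * (c * g' - k * y') ^ 2 + c * ((1 + y ^ 2 - g ^ 2) * (c * r - k * p)
      - 2 * (y * c - g * k) * (c * g' - k * y')) = 0 := by
  obtain rfl : n1 = k * n2 / c := by
    field_simp
    linear_combination hY
  apply mul_left_cancel₀ (pow_ne_zero 2 hn2)
  field_simp at rel
  linear_combination rel

/-- The equation satisfied by a ruled surface with conformal normal Gauss map. -/
theorem graphRuled_equation {Ω : Set (ℝ × ℝ)} (hΩ : IsOpen Ω) {I : Set ℝ} (hI : IsOpen I)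
    (hΩI : ∀ q ∈ Ω, q.2 ∈ I) {a y g h : ℝ → ℝ} (ha : ContDiffOn ℝ ∞ a I)
    (hy : ContDiffOn ℝ ∞ y I) (hg : ContDiffOn ℝ ∞ g I) (hh : ContDiffOn ℝ ∞ h I)
    {n : ℝ × ℝ → L3} (hn : DifferentiableOn ℝ n Ω) {ρ : ℝ × ℝ → ℝ}
    (hpos : ∀ q ∈ Ω, graphRuled a y g h q 2 ≠ 0)
    (hsp : ∀ q ∈ Ω, ∀ w : ℝ × ℝ, w ≠ 0 →
      0 < mink (fderiv ℝ (graphRuled a y g h) q w) (fderiv ℝ (graphRuled a y g h) q w))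
    (hnn : ∀ q ∈ Ω, mink (n q) (n q) = -1)
    (hnx : ∀ q ∈ Ω, ∀ w, mink (n q) (fderiv ℝ (graphRuled a y g h) q w) = 0)
    (hconf : ∀ q ∈ Ω, ∀ w w', mink (fderiv ℝ n q w) (fderiv ℝ n q w') = ρ q *
      (mink (fderiv ℝ n q w) (fderiv ℝ (graphRuled a y g h) q w') / graphRuled a y g h q 2
        - n q 2 * mink (fderiv ℝ (graphRuled a y g h) q w) (fderiv ℝ (graphRuled a y g h) q w')
          / graphRuled a y g h q 2 ^ 2))
    {u v : ℝ} (huv : (u, v) ∈ Ω) :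
    (h v + u * g v) * (deriv a v * deriv g v - deriv h v * deriv y v) ^ 2
      + (deriv a v + u * deriv y v) * ((1 + y v ^ 2 - g v ^ 2) *
        ((deriv a v + u * deriv y v) * (deriv (deriv h) v + u * deriv (deriv g) v)
          - (deriv h v + u * deriv g v) * (deriv (deriv a) v + u * deriv (deriv y) v))
        - 2 * (y v * (deriv a v + u * deriv y v) - g v * (deriv h v + u * deriv g v))
          * (deriv a v * deriv g v - deriv h v * deriv y v)) = 0 := by
  have d1 : ∀ {f : ℝ → ℝ}, ContDiffOn ℝ ∞ f I → ∀ t ∈ I, HasDerivAt f (deriv f t) t :=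
    fun hf t ht => ((hf.contDiffAt (hI.mem_nhds ht)).differentiableAt (by simp)).hasDerivAt
  have d2 : ∀ {f : ℝ → ℝ}, ContDiffOn ℝ ∞ f I → ContDiffOn ℝ ∞ (deriv f) I :=
    fun hf => ((contDiffOn_infty_iff_deriv_of_isOpen hI).1 hf).2
  have hvI := hΩI _ huv
  have hfd : ∀ q ∈ Ω, ∀ w, _ := fun q hq w => fderiv_graphRuled
    (d1 ha _ (hΩI q hq)).differentiableAt
    (d1 hy _ (hΩI q hq)).differentiableAt (d1 hg _ (hΩI q hq)).differentiableAt
    (d1 hh _ (hΩI q hq)).differentiableAt w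
  set n' := fderiv ℝ n (u, v) with hn'
  have hni : ∀ i, HasFDerivAt (fun q => n q i)
      ((ContinuousLinearMap.proj (R := ℝ) (φ := fun _ : Fin 3 => ℝ) i).comp n') (u, v) :=
    fun i => hasFDerivAt_pi'.1 (hn.differentiableAt (hΩ.mem_nhds huv)).hasFDerivAt i
  have key : ∀ {f : ℝ × ℝ → ℝ} {f' : ℝ × ℝ →L[ℝ] ℝ} {c : ℝ}, HasFDerivAt f f' (u, v) →
      (∀ q ∈ Ω, f q = c) → f' = 0 := fun hf h0 =>
    hf.unique ((hasFDerivAt_const _ _).congr_of_eventuallyEq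
      (Filter.eventually_of_mem (hΩ.mem_nhds huv) h0))
  -- Differentiating `⟨n, n⟩ = -1`, `⟨n, X⟩ = 0` and `⟨n, Y⟩ = 0` expresses all coefficients of
  -- `⟨dn, dx⟩` by `n` and the second derivatives of the surface.
  have kn := key ((((hni 0).mul (hni 0)).add ((hni 1).mul (hni 1))).sub ((hni 2).mul (hni 2))) hnn
  have kX := key (c := 0) (((hni 0).add ((hni 1).mul (hasFDerivAt_comp_snd (d1 hy v hvI)))).sub
    ((hni 2).mul (hasFDerivAt_comp_snd (d1 hg v hvI)))) (fun q hq => by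
      have := hnx q hq (1, 0)
      rw [hfd q hq] at this
      simpa [mink] using this)
  have kY := key (c := 0) (((hni 1).mul
      (hasFDerivAt_add_fst_mul (d1 (d2 ha) v hvI) (d1 (d2 hy) v hvI))).sub
    ((hni 2).mul (hasFDerivAt_add_fst_mul (d1 (d2 hh) v hvI) (d1 (d2 hg) v hvI))))
    (fun q hq => by
      have := hnx q hq (0, 1)
      rw [hfd q hq] at this
      simpa [mink] using this)
  have knu := DFunLike.congr_fun kn (1, 0)
  have knv := DFunLike.congr_fun kn (0, 1)
  have kXu := DFunLike.congr_fun kX (1, 0)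
  have kXv := DFunLike.congr_fun kX (0, 1)
  have kYu := DFunLike.congr_fun kY (1, 0)
  have kYv := DFunLike.congr_fun kY (0, 1)
  simp at knu knv kXu kXv kYu kYv
  have nX := hnx _ huv (1, 0)
  have nY := hnx _ huv (0, 1)
  have cAA := hconf _ huv (1, 0) (1, 0)
  have cAB := hconf _ huv (1, 0) (0, 1)
  have cBB := hconf _ huv (0, 1) (0, 1)
  rw [← hn'] at cAA cAB cBB
  have hE := hsp _ huv (1, 0) (by simp)
  have hG := hsp _ huv (0, 1) (by simp)
  set X := fderiv ℝ (graphRuled a y g h) (u, v) (1, 0) with hX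
  set Y := fderiv ℝ (graphRuled a y g h) (u, v) (0, 1) with hY
  have hW : 0 < mink X X * mink Y Y - mink X Y ^ 2 := by
    -- The vector `-F X + E Y` is orthogonal to `X` and has square `E (E G - F²)`.
    have := hsp _ huv (-mink X Y, mink X X) (by
      intro h0
      exact hE.ne' (Prod.ext_iff.1 h0).2)
    have e : fderiv ℝ (graphRuled a y g h) (u, v) (-mink X Y, mink X X)
        = (-mink X Y) • X + mink X X • Y := by
      rw [hX, hY, ← map_smul, ← map_smul, ← map_add]
      simp
    rw [e] at this
    have e2 : mink ((-mink X Y) • X + mink X X • Y) ((-mink X Y) • X + mink X X • Y)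
        = mink X X * (mink X X * mink Y Y - mink X Y ^ 2) := by
      simp only [mink, Pi.add_apply, Pi.smul_apply, smul_eq_mul]
      ring
    rw [e2] at this
    exact pos_of_mul_pos_right this hE.le
  have hXe := hfd _ huv (1, 0)
  have hYe := hfd _ huv (0, 1)
  rw [← hX] at hXe
  rw [← hY] at hYe
  simp at hXe hYe
  have X0 : X 0 = 1 := by rw [hXe]; rfl
  have X1 : X 1 = y v := by rw [hXe]; rfl
  have X2 : X 2 = g v := by rw [hXe]; rfl
  have Y0 : Y 0 = 0 := by rw [hYe]; rfl
  have Y1 : Y 1 = deriv a v + u * deriv y v := by rw [hYe]; rfl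
  have Y2 : Y 2 = deriv h v + u * deriv g v := by rw [hYe]; rfl
  have AX : mink (n' (1, 0)) X = 0 := by
    simp only [mink, X0, X1, X2]
    linear_combination kXu
  have AY : mink (n' (1, 0)) Y = -(n (u, v) 1 * deriv y v - n (u, v) 2 * deriv g v) := by
    simp only [mink, Y0, Y1, Y2]
    linear_combination kYu
  have BX : mink (n' (0, 1)) X = -(n (u, v) 1 * deriv y v - n (u, v) 2 * deriv g v) := by
    simp only [mink, X0, X1, X2]
    linear_combination kXv
  have BY : mink (n' (0, 1)) Y = -(n (u, v) 1 * (deriv (deriv a) v + u * deriv (deriv y) v)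
      - n (u, v) 2 * (deriv (deriv h) v + u * deriv (deriv g) v)) := by
    simp only [mink, Y0, Y1, Y2]
    linear_combination kYv
  have nA : mink (n (u, v)) (n' (1, 0)) = 0 := by
    simp only [mink]
    linear_combination (1 / 2) * knu
  have nB : mink (n (u, v)) (n' (0, 1)) = 0 := by
    simp only [mink]
    linear_combination (1 / 2) * knv
  have rel := curvature_relation_of_mink (hnn _ huv) nX nY hE hW (hpos _ huv) nA nB AX
    (BX.trans AY.symm) cAA cAB cBB
  rw [AY, BY] at rel
  have hz : graphRuled a y g h (u, v) 2 = h v + u * g v := rfl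
  have hn2 : n (u, v) 2 ≠ 0 := timelike_two_ne_zero (hnn _ huv)
  have hc : deriv a v + u * deriv y v ≠ 0 := by
    intro h0
    simp only [mink, Y0, Y1, Y2, h0] at hG
    linarith [mul_self_nonneg (deriv h v + u * deriv g v)]
  simp only [mink, X0, X1, X2, Y0, Y1, Y2, hz] at rel nY
  have := graph_curvature_relation (n1 := n (u, v) 1) (x := h v + u * g v) (y := y v) (g := g v)
    (y' := deriv y v) (g' := deriv g v) (k := deriv h v + u * deriv g v)
    (p := deriv (deriv a) v + u * deriv (deriv y) v)
    (r := deriv (deriv h) v + u * deriv (deriv g) v) hn2 hc (by linear_combination nY)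
    (by linear_combination rel)
  linear_combination this

/-- The conditions on `a`, `y`, `g`, `h` under which `graphRuled a y g h` is, over the
parameters `A × I`, a space-like surface with conformal normal Gauss map. -/
structure IsConformalGraph (A I : Set ℝ) (a y g h : ℝ → ℝ) : Prop where
  isOpen_fst : IsOpen A
  isOpen_snd : IsOpen I
  smooth_a : ContDiffOn ℝ ∞ a I
  smooth_y : ContDiffOn ℝ ∞ y I
  smooth_g : ContDiffOn ℝ ∞ g I
  smooth_h : ContDiffOn ℝ ∞ h I
  pos : ∀ u ∈ A, ∀ v ∈ I, 0 < h v + u * g v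
  spacelike : ∀ u ∈ A, ∀ v ∈ I, ∀ s t : ℝ, (s, t) ≠ (0, 0) →
    0 < s ^ 2 + (s * y v + t * (deriv a v + u * deriv y v)) ^ 2
      - (s * g v + t * (deriv h v + u * deriv g v)) ^ 2
  equation : ∀ u ∈ A, ∀ v ∈ I,
    (h v + u * g v) * (deriv a v * deriv g v - deriv h v * deriv y v) ^ 2
      + (deriv a v + u * deriv y v) * ((1 + y v ^ 2 - g v ^ 2) *
        ((deriv a v + u * deriv y v) * (deriv (deriv h) v + u * deriv (deriv g) v)
          - (deriv h v + u * deriv g v) * (deriv (deriv a) v + u * deriv (deriv y) v))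
        - 2 * (y v * (deriv a v + u * deriv y v) - g v * (deriv h v + u * deriv g v))
          * (deriv a v * deriv g v - deriv h v * deriv y v)) = 0

/-! ### The conformality equation as a polynomial along each ruling -/

theorem cubic_coeff_eq_zero {A : Set ℝ} (hA : IsOpen A) (hne : A.Nonempty) {c0 c1 c2 c3 : ℝ}
    (h : ∀ u ∈ A, c0 + c1 * u + c2 * u ^ 2 + c3 * u ^ 3 = 0) :
    c0 = 0 ∧ c1 = 0 ∧ c2 = 0 ∧ c3 = 0 := by
  set P : Polynomial ℝ := Polynomial.C c0 + Polynomial.C c1 * Polynomial.X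
    + Polynomial.C c2 * Polynomial.X ^ 2 + Polynomial.C c3 * Polynomial.X ^ 3 with hP
  have hinf : A.Infinite := by
    obtain ⟨x, hx⟩ := hne
    exact infinite_of_mem_nhds x (hA.mem_nhds hx)
  have h0 : P = 0 := by
    refine Polynomial.eq_zero_of_infinite_isRoot P (hinf.mono fun u hu => ?_)
    simpa [hP, Polynomial.IsRoot] using h u hu
  have hc : ∀ i, P.coeff i = 0 := fun i => by simp [h0]
  have e0 := hc 0
  have e1 := hc 1
  have e2 := hc 2
  have e3 := hc 3
  simp [hP, Polynomial.coeff_X, Polynomial.coeff_C, Polynomial.coeff_X_pow] at e0 e1 e2 e3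
  exact ⟨e0, e1, e2, e3⟩

/-- This frees `u` from the parameter set `A`; the value needed later is the root of `a' + u y'`,
which space-likeness excludes from `A`. -/
theorem polynomial_identity_of_isOpen {A : Set ℝ} (hA : IsOpen A) (hne : A.Nonempty)
    {h g Δ a1 y1 E h1 g1 h2 g2 a2 y2 y : ℝ}
    (he : ∀ u ∈ A, (h + u * g) * Δ ^ 2 + (a1 + u * y1) * (E * ((a1 + u * y1) * (h2 + u * g2)
      - (h1 + u * g1) * (a2 + u * y2)) - 2 * (y * (a1 + u * y1) - g * (h1 + u * g1)) * Δ) = 0)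
    (u : ℝ) : (h + u * g) * Δ ^ 2 + (a1 + u * y1) * (E * ((a1 + u * y1) * (h2 + u * g2)
      - (h1 + u * g1) * (a2 + u * y2)) - 2 * (y * (a1 + u * y1) - g * (h1 + u * g1)) * Δ) = 0 := by
  obtain ⟨e0, e1, e2, e3⟩ := cubic_coeff_eq_zero hA hne
    (c0 := h * Δ ^ 2 + a1 * (E * (a1 * h2 - h1 * a2) - 2 * (y * a1 - g * h1) * Δ))
    (c1 := g * Δ ^ 2 + y1 * (E * (a1 * h2 - h1 * a2) - 2 * (y * a1 - g * h1) * Δ)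
      + a1 * (E * (a1 * g2 + y1 * h2 - h1 * y2 - g1 * a2) - 2 * (y * y1 - g * g1) * Δ))
    (c2 := y1 * (E * (a1 * g2 + y1 * h2 - h1 * y2 - g1 * a2) - 2 * (y * y1 - g * g1) * Δ)
      + a1 * (E * (y1 * g2 - g1 * y2)))
    (c3 := y1 * (E * (y1 * g2 - g1 * y2)))
    (fun u hu => by linear_combination he u hu)
  linear_combination e0 + u * e1 + u ^ 2 * e2 + u ^ 3 * e3

/-- By `h0`, `y1 (h + u g) = g (a1 + u y1)`, so `a1 + u y1` divides `y1` times the cubic. The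
quotient `r0 + r1 u + r2 u²` vanishes identically; its value at `u = -a1 / y1`, combined with the
differentiated relation `hd`, leaves `(1 + y²) Δ² y1 = 0`. -/
theorem disc_eq_zero_of_identity {h g Δ a1 y1 h1 g1 h2 g2 a2 y2 y : ℝ} (hy1 : y1 ≠ 0)
    (hΔ : Δ = a1 * g1 - h1 * y1)
    (he : ∀ u, (h + u * g) * Δ ^ 2 + (a1 + u * y1) * ((1 + y ^ 2 - g ^ 2) *
      ((a1 + u * y1) * (h2 + u * g2) - (h1 + u * g1) * (a2 + u * y2))
      - 2 * (y * (a1 + u * y1) - g * (h1 + u * g1)) * Δ) = 0)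
    (h0 : h * y1 - g * a1 = 0) (hd : h1 * y1 + h * y2 - g1 * a1 - g * a2 = 0) : Δ = 0 := by
  obtain ⟨E, hE⟩ : ∃ E, E = 1 + y ^ 2 - g ^ 2 := ⟨_, rfl⟩
  obtain ⟨r0, hr0⟩ : ∃ r, r = g * Δ ^ 2
    + y1 * (E * (a1 * h2 - h1 * a2) - 2 * (y * a1 - g * h1) * Δ) := ⟨_, rfl⟩
  obtain ⟨r1, hr1⟩ : ∃ r, r = y1 * (E * (a1 * g2 + y1 * h2 - h1 * y2 - g1 * a2)
    - 2 * (y * y1 - g * g1) * Δ) := ⟨_, rfl⟩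
  obtain ⟨r2, hr2⟩ : ∃ r, r = y1 * (E * (y1 * g2 - g1 * y2)) := ⟨_, rfl⟩
  obtain ⟨-, e1, e2, e3⟩ := cubic_coeff_eq_zero isOpen_univ Set.univ_nonempty (c0 := a1 * r0)
    (c1 := y1 * r0 + a1 * r1) (c2 := y1 * r1 + a1 * r2) (c3 := y1 * r2)
    (fun u _ => by
      have := he u
      rw [← hE] at this
      rw [hr0, hr1, hr2]
      linear_combination y1 * this - Δ ^ 2 * h0)
  have z2 : r2 = 0 := (mul_eq_zero.1 e3).resolve_left hy1
  have z1 : r1 = 0 := by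
    rw [z2] at e2
    exact (mul_eq_zero.1 (by linear_combination e2 : y1 * r1 = 0)).resolve_left hy1
  have z0 : r0 = 0 := by
    rw [z1] at e1
    exact (mul_eq_zero.1 (by linear_combination e1 : y1 * r0 = 0)).resolve_left hy1
  have hX : y1 * (E * Δ * (a2 * y1 - a1 * y2) - g * Δ ^ 2 * y1) = 0 := by
    have : y1 ^ 2 * r0 - a1 * y1 * r1 + a1 ^ 2 * r2 = 0 := by
      rw [z0, z1, z2]; ring
    rw [hr0, hr1, hr2] at this
    subst hΔ
    linear_combination this
  have hX' := (mul_eq_zero.1 hX).resolve_left hy1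
  have : (1 + y ^ 2) * Δ ^ 2 * y1 = 0 := by
    have hk : g * (a2 * y1 - a1 * y2) = -Δ * y1 := by
      rw [hΔ]
      linear_combination -y1 * hd + y2 * h0
    linear_combination -g * hX' + E * Δ * hk - Δ ^ 2 * y1 * hE
  have h1 := (mul_eq_zero.1 this).resolve_right hy1
  exact pow_eq_zero_iff two_ne_zero |>.1
    ((mul_eq_zero.1 h1).resolve_left (by positivity))

namespace IsConformalGraph

variable {A I : Set ℝ} {a y g h : ℝ → ℝ}

theorem hasDerivAt_of_contDiffOn {f : ℝ → ℝ} {I : Set ℝ} (hI : IsOpen I)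
    (hf : ContDiffOn ℝ ∞ f I) {v : ℝ} (hv : v ∈ I) : HasDerivAt f (deriv f v) v :=
  ((hf.contDiffAt (hI.mem_nhds hv)).differentiableAt (by simp)).hasDerivAt

theorem contDiffOn_deriv {f : ℝ → ℝ} {I : Set ℝ} (hI : IsOpen I)
    (hf : ContDiffOn ℝ ∞ f I) : ContDiffOn ℝ ∞ (deriv f) I :=
  ((contDiffOn_infty_iff_deriv_of_isOpen hI).1 hf).2

theorem equation' (H : IsConformalGraph A I a y g h) (hA : A.Nonempty) {v : ℝ} (hv : v ∈ I)
    (u : ℝ) : (h v + u * g v) * (deriv a v * deriv g v - deriv h v * deriv y v) ^ 2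
      + (deriv a v + u * deriv y v) * ((1 + y v ^ 2 - g v ^ 2) *
        ((deriv a v + u * deriv y v) * (deriv (deriv h) v + u * deriv (deriv g) v)
          - (deriv h v + u * deriv g v) * (deriv (deriv a) v + u * deriv (deriv y) v))
        - 2 * (y v * (deriv a v + u * deriv y v) - g v * (deriv h v + u * deriv g v))
          * (deriv a v * deriv g v - deriv h v * deriv y v)) = 0 :=
  polynomial_identity_of_isOpen H.isOpen_fst hA (fun u hu => H.equation u hu v hv) u

theorem normSq_pos (H : IsConformalGraph A I a y g h) (hA : A.Nonempty) {v : ℝ} (hv : v ∈ I) :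
    0 < 1 + y v ^ 2 - g v ^ 2 := by
  obtain ⟨u, hu⟩ := hA
  have := H.spacelike u hu v hv 1 0 (by simp)
  linarith

theorem ne_zero (H : IsConformalGraph A I a y g h) {u v : ℝ} (hu : u ∈ A) (hv : v ∈ I) :
    deriv a v + u * deriv y v ≠ 0 := by
  intro h0
  have := H.spacelike u hu v hv 0 1 (by simp)
  rw [h0] at this
  nlinarith [sq_nonneg (deriv h v + u * deriv g v)]

/-- Where the directions of the rulings do not stay parallel to a vertical plane, the surface
is flat. -/
theorem disc_eq_zero (H : IsConformalGraph A I a y g h) (hA : A.Nonempty) {v : ℝ} (hv : v ∈ I)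
    (hy1 : deriv y v ≠ 0) : deriv a v * deriv g v - deriv h v * deriv y v = 0 := by
  by_contra hΔ
  have da := H.smooth_a
  have dy := H.smooth_y
  have dg := H.smooth_g
  have dh := H.smooth_h
  have hI := H.isOpen_snd
  have ca := contDiffOn_deriv hI da
  have cy := contDiffOn_deriv hI dy
  have cg := contDiffOn_deriv hI dg
  have ch := contDiffOn_deriv hI dh
  have hnhds := hI.mem_nhds hv
  have at' : ∀ {f : ℝ → ℝ}, ContDiffOn ℝ ∞ f I → ContinuousAt f v :=
    fun hf => hf.continuousOn.continuousAt hnhds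
  have hev : ∀ᶠ t in nhds v, h t * deriv y t - g t * deriv a t = 0 := by
    have e1 := (at' cy).eventually_ne hy1
    have e2 := (((at' ca).mul (at' cg)).sub ((at' ch).mul (at' cy))).eventually_ne hΔ
    filter_upwards [e1, e2, hnhds] with t h1 h2 ht
    -- At the root of `a' + u y'` only the term `(h + u g) Δ²` remains.
    have := H.equation' hA ht (-deriv a t / deriv y t)
    have h0 : deriv a t + -deriv a t / deriv y t * deriv y t = 0 := by field_simp; ring
    rw [h0] at this
    have h3 : (h t + -deriv a t / deriv y t * g t) *
      (deriv a t * deriv g t - deriv h t * deriv y t) ^ 2 = 0 := by linear_combination this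
    have h4 := (mul_eq_zero.1 h3).resolve_right (pow_ne_zero 2 h2)
    field_simp at h4
    linear_combination h4
  have hd := ((hasDerivAt_of_contDiffOn hI dh hv).mul (hasDerivAt_of_contDiffOn hI cy hv)).sub
    ((hasDerivAt_of_contDiffOn hI dg hv).mul (hasDerivAt_of_contDiffOn hI ca hv))
  have hd0 := hd.unique ((hasDerivAt_const v (0 : ℝ)).congr_of_eventuallyEq hev)
  exact hΔ (disc_eq_zero_of_identity hy1 rfl (H.equation' hA hv) hev.self_of_nhds
    (by linear_combination hd0))

end IsConformalGraph

/-! ### Integration of the equations: flat and non-flat graphs -/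

theorem eq_of_hasDerivAt_zero {f : ℝ → ℝ} {c r : ℝ}
    (hf : ∀ t ∈ Metric.ball c r, HasDerivAt f 0 t) {t : ℝ} (ht : t ∈ Metric.ball c r) :
    f t = f c :=
  Metric.isOpen_ball.is_const_of_deriv_eq_zero (convex_ball c r).isPreconnected
    (fun t ht => (hf t ht).differentiableAt.differentiableWithinAt) (fun t ht => (hf t ht).deriv) ht
    (Metric.mem_ball_self (Metric.pos_of_mem_ball ht))

namespace IsConformalGraph

variable {A I : Set ℝ} {a y g h : ℝ → ℝ}

/-- The conformality equation of a graph whose rulings stay parallel to a vertical plane. -/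
theorem parallel_equations (H : IsConformalGraph A I a y g h) (hA : A.Nonempty) {v : ℝ}
    (hv : v ∈ I) (hy1 : deriv y v = 0) (hy2 : deriv (deriv y) v = 0) :
    3 * g v * deriv g v ^ 2 * deriv a v + (1 + y v ^ 2 - g v ^ 2)
        * (deriv a v * deriv (deriv g) v - deriv g v * deriv (deriv a) v) = 0 ∧
    h v * deriv g v ^ 2 * deriv a v + (1 + y v ^ 2 - g v ^ 2)
        * (deriv a v * deriv (deriv h) v - deriv h v * deriv (deriv a) v)
        - 2 * deriv a v * deriv g v * (y v * deriv a v - g v * deriv h v) = 0 := by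
  have ha1 : deriv a v ≠ 0 := by
    obtain ⟨u, hu⟩ := hA
    simpa [hy1] using H.ne_zero hu hv
  have e0 := H.equation' hA hv 0
  have e1 := H.equation' hA hv 1
  rw [hy1, hy2] at e0 e1
  constructor
  · apply mul_left_cancel₀ ha1
    linear_combination e1 - e0
  · apply mul_left_cancel₀ ha1
    linear_combination e0

/-- Flatness at a ruling propagates to the neighbouring rulings. -/
theorem eventually_disc_eq_zero (H : IsConformalGraph A I a y g h) (hA : A.Nonempty) {v : ℝ}
    (hv : v ∈ I) (h0 : deriv a v * deriv g v - deriv h v * deriv y v = 0) :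
    ∀ᶠ t in nhds v, deriv a t * deriv g t - deriv h t * deriv y t = 0 := by
  have hI := H.isOpen_snd
  have ca := contDiffOn_deriv hI H.smooth_a
  have cy := contDiffOn_deriv hI H.smooth_y
  have cg := contDiffOn_deriv hI H.smooth_g
  have ch := contDiffOn_deriv hI H.smooth_h
  have hnhds := hI.mem_nhds hv
  by_cases hy1 : deriv y v = 0
  · have ha1 : deriv a v ≠ 0 := by
      obtain ⟨u, hu⟩ := hA
      simpa [hy1] using H.ne_zero hu hv
    obtain ⟨r, hr, hball⟩ := Metric.eventually_nhds_iff_ball.1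
      (((ca.continuousOn.continuousAt hnhds).eventually_ne ha1).and hnhds)
    -- Where `y' = 0` this is the square of `g' / (a' E^(3/2))`, `E = 1 + y² - g²`, a first integral
    -- of the first parallel equation. The square also makes the derivative vanish where `Δ = 0`,
    -- with no information on `y'` there.
    set D : ℝ → ℝ := fun t => (deriv a t * deriv g t - deriv h t * deriv y t) ^ 2
      / (deriv a t ^ 4 * (1 + y t ^ 2 - g t ^ 2) ^ 3) with hD
    have hD0 : ∀ t ∈ Metric.ball v r, HasDerivAt D 0 t := by
      intro t ht
      obtain ⟨hat, htI⟩ := hball t ht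
      have hE := (H.normSq_pos hA htI).ne'
      have h1 := ((((hasDerivAt_of_contDiffOn hI ca htI).mul
        (hasDerivAt_of_contDiffOn hI cg htI)).sub ((hasDerivAt_of_contDiffOn hI ch htI).mul
        (hasDerivAt_of_contDiffOn hI cy htI))).pow 2).div
        (((hasDerivAt_of_contDiffOn hI ca htI).pow 4).mul
          (((((hasDerivAt_of_contDiffOn hI H.smooth_y htI).pow 2).const_add 1).sub
            ((hasDerivAt_of_contDiffOn hI H.smooth_g htI).pow 2)).pow 3))
        (mul_ne_zero (pow_ne_zero 4 hat) (pow_ne_zero 3 hE))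
      refine h1.congr_deriv ?_
      simp only [Pi.mul_apply, Pi.sub_apply, Pi.pow_apply]
      refine div_eq_zero_iff.2 (Or.inl ?_)
      by_cases hΔ : deriv a t * deriv g t - deriv h t * deriv y t = 0
      · rw [hΔ]; simp
      · have hev : ∀ᶠ s in nhds t, deriv y s = 0 := by
          filter_upwards [((((ca.continuousOn.continuousAt (hI.mem_nhds htI)).mul
            (cg.continuousOn.continuousAt (hI.mem_nhds htI))).sub
            ((ch.continuousOn.continuousAt (hI.mem_nhds htI)).mul
            (cy.continuousOn.continuousAt (hI.mem_nhds htI)))).eventually_ne hΔ),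
            hI.mem_nhds htI] with s hs hsI
          by_contra hne
          exact hs (H.disc_eq_zero hA hsI hne)
        have z1 := hev.self_of_nhds
        have z2 : deriv (deriv y) t = 0 := by
          have := Filter.EventuallyEq.deriv_eq (f := fun _ => (0 : ℝ)) hev
          simpa using this
        have e := (H.parallel_equations hA htI z1 z2).1
        rw [z1, z2]
        push_cast
        simp only [pow_one, mul_zero, sub_zero, zero_sub, add_zero]
        linear_combination 2 * deriv a t ^ 5 * deriv g t * (1 + y t ^ 2 - g t ^ 2) ^ 2 * e
    refine Metric.eventually_nhds_iff_ball.2 ⟨r, hr, fun t ht => ?_⟩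
    obtain ⟨hat, htI⟩ := hball t ht
    have hE := (H.normSq_pos hA htI).ne'
    have e := eq_of_hasDerivAt_zero hD0 ht
    have e' : D t = 0 := by
      rw [e, hD]
      simp [h0]
    have := (div_eq_zero_iff.1 e').resolve_right
      (mul_ne_zero (pow_ne_zero 4 hat) (pow_ne_zero 3 hE))
    exact pow_eq_zero_iff two_ne_zero |>.1 this
  · filter_upwards [(cy.continuousOn.continuousAt hnhds).eventually_ne hy1, hnhds] with t ht htI
    exact H.disc_eq_zero hA htI ht

/-- A flat conformal graph lies in a plane. -/
theorem exists_plane (H : IsConformalGraph A I a y g h) (hA : A.Nonempty) {v : ℝ}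
    (hv : v ∈ I) (h0 : deriv a v * deriv g v - deriv h v * deriv y v = 0) :
    ∃ r > 0, Metric.ball v r ⊆ I ∧ ∃ τ p c : ℝ, ∀ t ∈ Metric.ball v r,
      g t = p + τ * y t ∧ h t = c + τ * a t := by
  have hI := H.isOpen_snd
  have ca := contDiffOn_deriv hI H.smooth_a
  have cy := contDiffOn_deriv hI H.smooth_y
  have cg := contDiffOn_deriv hI H.smooth_g
  have ch := contDiffOn_deriv hI H.smooth_h
  obtain ⟨r, hr, hball⟩ := Metric.eventually_nhds_iff_ball.1
      ((H.eventually_disc_eq_zero hA hv h0).and (hI.mem_nhds hv))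
  refine ⟨r, hr, fun t ht => (hball t ht).2, ?_⟩
  have ⟨u, hu⟩ := hA
  -- The slope of the tangent plane in the `(x₂, x₃)`-directions. `Δ = 0` makes it independent of
  -- `u`, and the conformality equation makes it independent of `t`.
  set T : ℝ → ℝ := fun t => (deriv h t + u * deriv g t) / (deriv a t + u * deriv y t) with hT
  have hTd : ∀ t ∈ Metric.ball v r, HasDerivAt T 0 t := by
    intro t ht
    obtain ⟨hΔ, htI⟩ := hball t ht
    have hc := H.ne_zero hu htI
    have h1 := ((hasDerivAt_of_contDiffOn hI ch htI).add
      ((hasDerivAt_of_contDiffOn hI cg htI).const_mul u)).div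
      ((hasDerivAt_of_contDiffOn hI ca htI).add
      ((hasDerivAt_of_contDiffOn hI cy htI).const_mul u)) hc
    refine h1.congr_deriv ?_
    simp only [Pi.add_apply]
    refine div_eq_zero_iff.2 (Or.inl ?_)
    have e := H.equation u hu t htI
    rw [hΔ] at e
    apply mul_left_cancel₀ (mul_ne_zero hc (H.normSq_pos hA htI).ne')
    linear_combination e
  have hTc : ∀ t ∈ Metric.ball v r, deriv g t = T v * deriv y t ∧ deriv h t = T v * deriv a t := by
    intro t ht
    obtain ⟨hΔ, htI⟩ := hball t ht
    have hc := H.ne_zero hu htI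
    rw [← eq_of_hasDerivAt_zero hTd ht, hT]
    constructor
    · field_simp
      linear_combination hΔ
    · field_simp
      linear_combination -u * hΔ
  refine ⟨T v, g v - T v * y v, h v - T v * a v, fun t ht => ⟨?_, ?_⟩⟩
  · have := eq_of_hasDerivAt_zero (f := fun t => g t - T v * y t) (fun s hs =>
      ((hasDerivAt_of_contDiffOn hI H.smooth_g (hball s hs).2).sub
      ((hasDerivAt_of_contDiffOn hI H.smooth_y (hball s hs).2).const_mul (T v))).congr_deriv
      (by rw [(hTc s hs).1]; ring)) ht
    linear_combination this
  · have := eq_of_hasDerivAt_zero (f := fun t => h t - T v * a t) (fun s hs =>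
      ((hasDerivAt_of_contDiffOn hI H.smooth_h (hball s hs).2).sub
      ((hasDerivAt_of_contDiffOn hI H.smooth_a (hball s hs).2).const_mul (T v))).congr_deriv
      (by rw [(hTc s hs).2]; ring)) ht
    linear_combination this

/-- Here `1 - g²` is the Minkowski square of the ruling direction `(1, 0, g)`. For `f = g` the
numerator reduces to `g'`. -/
theorem hasDerivAt_div_sqrt {f g : ℝ → ℝ} {f' g' t : ℝ} (hf : HasDerivAt f f' t)
    (hg : HasDerivAt g g' t) (hE : 0 < 1 - g t ^ 2) :
    HasDerivAt (fun t => f t / √(1 - g t ^ 2))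
      ((f' * (1 - g t ^ 2) + g t * g' * f t) / √(1 - g t ^ 2) ^ 3) t := by
  have h1 := hf.div (((hg.pow 2).const_sub 1).sqrt hE.ne') (Real.sqrt_pos.2 hE).ne'
  refine h1.congr_deriv ?_
  have hs := (Real.sqrt_pos.2 hE).ne'
  have h2 := Real.sq_sqrt hE.le
  simp only [Pi.pow_apply]
  field_simp
  rw [h2]
  push_cast
  ring

/-- A non-flat conformal graph: the parameters of its rulings are affine functions of `a`. -/
theorem exists_affine (H : IsConformalGraph A I a y g h) (hA : A.Nonempty) {v : ℝ}
    (hv : v ∈ I) (hyv : y v = 0) (h0 : deriv a v * deriv g v - deriv h v * deriv y v ≠ 0) :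
    ∃ r > 0, Metric.ball v r ⊆ I ∧ ∃ k k₀ m m₀ : ℝ, k ≠ 0 ∧ ∀ t ∈ Metric.ball v r,
      y t = 0 ∧ g t / √(1 - g t ^ 2) = k * a t + k₀ ∧ h t / √(1 - g t ^ 2) = m * a t + m₀ := by
  have hI := H.isOpen_snd
  have ca := contDiffOn_deriv hI H.smooth_a
  have cy := contDiffOn_deriv hI H.smooth_y
  have cg := contDiffOn_deriv hI H.smooth_g
  have ch := contDiffOn_deriv hI H.smooth_h
  have hnhds := hI.mem_nhds hv
  obtain ⟨r, hr, hball⟩ := Metric.eventually_nhds_iff_ball.1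
    ((((((ca.continuousOn.continuousAt hnhds).mul
            (cg.continuousOn.continuousAt hnhds)).sub
            ((ch.continuousOn.continuousAt hnhds).mul
            (cy.continuousOn.continuousAt hnhds))).eventually_ne h0)).and hnhds)
  refine ⟨r, hr, fun t ht => (hball t ht).2, ?_⟩
  have y1 : ∀ t ∈ Metric.ball v r, deriv y t = 0 := by
    intro t ht
    by_contra hne
    exact (hball t ht).1 (H.disc_eq_zero hA (hball t ht).2 hne)
  have y0 : ∀ t ∈ Metric.ball v r, y t = 0 := by
    intro t ht
    rw [← hyv]
    exact eq_of_hasDerivAt_zero (fun s hs => (hasDerivAt_of_contDiffOn hI H.smooth_y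
      (hball s hs).2).congr_deriv (y1 s hs)) ht
  have y2 : ∀ t ∈ Metric.ball v r, deriv (deriv y) t = 0 := by
    intro t ht
    have hev : deriv y =ᶠ[nhds t] fun _ => (0 : ℝ) :=
      Filter.eventually_of_mem (Metric.isOpen_ball.mem_nhds ht) y1
    simpa using hev.deriv_eq
  have ha1 : ∀ t ∈ Metric.ball v r, deriv a t ≠ 0 := by
    intro t ht h
    apply (hball t ht).1
    simp [h, y1 t ht]
  have hE : ∀ t ∈ Metric.ball v r, 0 < 1 - g t ^ 2 := by
    intro t ht
    have := H.normSq_pos hA (hball t ht).2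
    rw [y0 t ht] at this
    linarith
  have eqs := fun t ht => H.parallel_equations hA (hball t ht).2 (y1 t ht) (y2 t ht)
  have dS : ∀ {f : ℝ → ℝ}, ContDiffOn ℝ ∞ f I → ∀ t ∈ Metric.ball v r,
      HasDerivAt (fun t => f t / √(1 - g t ^ 2))
        ((deriv f t * (1 - g t ^ 2) + g t * deriv g t * f t) / √(1 - g t ^ 2) ^ 3) t :=
    fun hf t ht => hasDerivAt_div_sqrt (hasDerivAt_of_contDiffOn hI hf (hball t ht).2)
      (hasDerivAt_of_contDiffOn hI H.smooth_g (hball t ht).2) (hE t ht)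
  -- The hypothesis is the vanishing, up to nonzero factors, of the derivative of `(f / √(1 - g²))'
  -- / a'`. For `f = g` it is the first parallel equation; for `f = h` it is a combination of both.
  have main : ∀ {f : ℝ → ℝ}, ContDiffOn ℝ ∞ f I → (∀ t ∈ Metric.ball v r,
      (1 - g t ^ 2) * ((1 - g t ^ 2) * (deriv a t * deriv (deriv f) t
        - deriv f t * deriv (deriv a) t) + 2 * g t * deriv g t * deriv f t * deriv a t
        + deriv g t ^ 2 * f t * deriv a t) + g t * f t * ((1 - g t ^ 2) *
        (deriv a t * deriv (deriv g) t - deriv g t * deriv (deriv a) t)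
        + 3 * g t * deriv g t ^ 2 * deriv a t) = 0) →
      ∀ t ∈ Metric.ball v r, (deriv f t * (1 - g t ^ 2) + g t * deriv g t * f t)
        / √(1 - g t ^ 2) ^ 3 = (deriv f v * (1 - g v ^ 2) + g v * deriv g v * f v)
        / √(1 - g v ^ 2) ^ 3 / deriv a v * deriv a t := by
    intro f hf hode t ht
    have hc := eq_of_hasDerivAt_zero (c := v) (r := r)
      (f := fun t => (deriv f t * (1 - g t ^ 2) + g t * deriv g t * f t)
        / √(1 - g t ^ 2) ^ 3 / deriv a t) (fun s hs => by
      have hsI := (hball s hs).2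
      have df := hasDerivAt_of_contDiffOn hI hf hsI
      have ddf := hasDerivAt_of_contDiffOn hI (contDiffOn_deriv hI hf) hsI
      have dg := hasDerivAt_of_contDiffOn hI H.smooth_g hsI
      have ddg := hasDerivAt_of_contDiffOn hI cg hsI
      have dda := hasDerivAt_of_contDiffOn hI ca hsI
      have hEs := hE s hs
      have hsq := (Real.sqrt_pos.2 hEs).ne'
      have h2 := Real.sq_sqrt hEs.le
      have hd := (((ddf.mul ((dg.pow 2).const_sub 1)).add ((dg.mul ddg).mul df)).div
        ((((dg.pow 2).const_sub 1).sqrt hEs.ne').pow 3) (pow_ne_zero 3 hsq)).div dda (ha1 s hs)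
      refine hd.congr_deriv ?_
      have ha1s := ha1 s hs
      have ho := hode s hs
      simp only [Pi.mul_apply, Pi.add_apply, Pi.pow_apply, Pi.div_apply]
      rw [div_eq_zero_iff]
      left
      field_simp
      have h4 : √(1 - g s ^ 2) ^ 4 = (1 - g s ^ 2) ^ 2 := by
        rw [← h2, ← pow_mul, h2]
      norm_num
      rw [h4, h2]
      linear_combination 2 * (1 - g s ^ 2) * ho) ht
    rw [← hc]
    have := ha1 t ht
    field_simp
  have mg := main H.smooth_g (fun t ht => by
    obtain ⟨e1, e2⟩ := eqs t ht
    rw [y0 t ht] at e1 e2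
    linear_combination e1)
  have mh := main H.smooth_h (fun t ht => by
    obtain ⟨e1, e2⟩ := eqs t ht
    rw [y0 t ht] at e1 e2
    linear_combination (1 - g t ^ 2) * e2 + g t * h t * e1)
  set k := (deriv g v * (1 - g v ^ 2) + g v * deriv g v * g v)
        / √(1 - g v ^ 2) ^ 3 / deriv a v with hk
  set m := (deriv h v * (1 - g v ^ 2) + g v * deriv g v * h v)
        / √(1 - g v ^ 2) ^ 3 / deriv a v with hm
  have hvb := Metric.mem_ball_self (x := v) hr
  refine ⟨k, g v / √(1 - g v ^ 2) - k * a v, m, h v / √(1 - g v ^ 2) - m * a v, ?_,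
    fun t ht => ⟨y0 t ht, ?_, ?_⟩⟩
  · have hg1 : deriv g v ≠ 0 := by
      intro h
      apply h0
      simp [h, y1 v hvb]
    have e : deriv g v * (1 - g v ^ 2) + g v * deriv g v * g v = deriv g v := by ring
    rw [hk, e]
    exact div_ne_zero (div_ne_zero hg1 (pow_ne_zero 3 (Real.sqrt_pos.2 (hE v hvb)).ne'))
      (ha1 v hvb)
  · have := eq_of_hasDerivAt_zero (f := fun t => g t / √(1 - g t ^ 2) - k * a t) (fun s hs =>
      ((dS H.smooth_g s hs).sub ((hasDerivAt_of_contDiffOn hI H.smooth_a (hball s hs).2).const_mul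
        k)).congr_deriv (by rw [mg s hs]; ring)) ht
    linear_combination this
  · have := eq_of_hasDerivAt_zero (f := fun t => h t / √(1 - g t ^ 2) - m * a t) (fun s hs =>
      ((dS H.smooth_h s hs).sub ((hasDerivAt_of_contDiffOn hI H.smooth_a (hball s hs).2).const_mul
        m)).congr_deriv (by rw [mh s hs]; ring)) ht
    linear_combination this

end IsConformalGraph

/-! ### Changes of parameters, rotations and the reduction to graphs -/

/-- A smooth map `f` through which an immersion `x` factors is a smooth change of parameters. -/
theorem isPartOfNear_of_comp {x S : ℝ × ℝ → L3} {D U : Set (ℝ × ℝ)} (hU : IsOpen U)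
    (hUD : U ⊆ D) {p : ℝ × ℝ} (hp : p ∈ U) {f : ℝ × ℝ → ℝ × ℝ} (hf : ContDiffOn ℝ ∞ f U)
    (hS : Differentiable ℝ S) (hx : ∀ q ∈ U, x q = S (f q))
    (hinj : ∀ q ∈ U, ∀ w, fderiv ℝ x q w = 0 → w = 0) : IsPartOfNear x D p S := by
  have hfa : ∀ q ∈ U, ContDiffAt ℝ ∞ f q := fun q hq => hf.contDiffAt (hU.mem_nhds hq)
  have hequiv : ∀ q ∈ U, ∃ e : (ℝ × ℝ) ≃L[ℝ] (ℝ × ℝ),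
      HasFDerivAt f (e : (ℝ × ℝ) →L[ℝ] (ℝ × ℝ)) q := by
    intro q hq
    have hd := ((hfa q hq).differentiableAt (by simp)).hasFDerivAt
    have hxd : HasFDerivAt x ((fderiv ℝ S (f q)).comp (fderiv ℝ f q)) q :=
      ((hS (f q)).hasFDerivAt.comp q hd).congr_of_eventuallyEq
        (Filter.eventually_of_mem (hU.mem_nhds hq) hx)
    -- As `dx = dS ∘ df` is injective, so is `df`; the inverse function theorem then applies at
    -- every point of `U`.
    have hi : Function.Injective (fderiv ℝ f q : (ℝ × ℝ) →ₗ[ℝ] (ℝ × ℝ)) := by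
      rw [injective_iff_map_eq_zero]
      intro w hw
      apply hinj q hq w
      have hw' : fderiv ℝ f q w = 0 := hw
      rw [hxd.fderiv, ContinuousLinearMap.comp_apply, hw', map_zero]
    refine ⟨(LinearEquiv.ofInjectiveEndo _ hi).toContinuousLinearEquiv, hd.congr_fderiv ?_⟩
    exact ContinuousLinearMap.ext fun w => rfl
  obtain ⟨e, he⟩ := hequiv p hp
  set φ := ((hfa p hp).toOpenPartialHomeomorph f he (by simp)).restrOpen U hU with hφ
  have hφf : ∀ q, φ q = f q := fun q => rfl
  have hsub : φ.source ⊆ U := fun q hq => hq.2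
  refine ⟨φ, ⟨(hfa p hp).mem_toOpenPartialHomeomorph_source he (by simp), hp⟩, hsub.trans hUD,
    hf.mono hsub, fun z hz => ?_, fun q hq => hx q (hsub hq)⟩
  have hq := hsub (φ.map_target hz)
  obtain ⟨e', he'⟩ := hequiv _ hq
  exact (φ.contDiffAt_symm hz he' (hfa _ hq)).contDiffWithinAt

/-- The rotation by `θ` in the `(x₁, x₂)`-plane. -/
noncomputable def rotL (θ : ℝ) : L3 →L[ℝ] L3 :=
  LinearMap.toContinuousLinearMap
    { toFun := rotTrans θ 0 0
      map_add' := fun X Y => by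
        funext i
        fin_cases i <;> simp [rotTrans] <;> ring
      map_smul' := fun c X => by
        funext i
        fin_cases i <;> simp [rotTrans] <;> ring }

theorem rotL_apply (θ : ℝ) (X : L3) : rotL θ X = rotTrans θ 0 0 X := rfl

theorem mink_rotL (θ : ℝ) (X Y : L3) : mink (rotL θ X) (rotL θ Y) = mink X Y := by
  simp [rotL_apply, rotTrans, mink]
  linear_combination (X 0 * Y 0 + X 1 * Y 1) * Real.sin_sq_add_cos_sq θ

theorem rotTrans_eq (θ a b : ℝ) (X : L3) : rotTrans θ a b X = rotL θ X + ![a, b, 0] := by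
  funext i
  fin_cases i <;> simp [rotL_apply, rotTrans]

theorem exists_rotL {X : L3} (hX : 0 < mink X X) :
    ∃ θ, 0 < rotL θ X 0 ∧ rotL θ X 1 = 0 := by
  -- The horizontal part of a space-like vector is nonzero; rotating by minus its argument puts it
  -- on the positive `x₁`-axis.
  set z : ℂ := ⟨X 0, X 1⟩ with hz
  have hz0 : z ≠ 0 := by
    intro h
    have h0 : X 0 = 0 := congrArg Complex.re h
    have h1 : X 1 = 0 := congrArg Complex.im h
    rw [mink, h0, h1] at hX
    nlinarith [sq_nonneg (X 2)]
  have hc : ‖z‖ * Real.cos z.arg = X 0 := Complex.norm_mul_cos_arg z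
  have hs : ‖z‖ * Real.sin z.arg = X 1 := Complex.norm_mul_sin_arg z
  refine ⟨-z.arg, ?_, ?_⟩
  · have : rotL (-z.arg) X 0 = ‖z‖ := by
      simp [rotL_apply, rotTrans]
      rw [← hc, ← hs]
      linear_combination ‖z‖ * Real.sin_sq_add_cos_sq z.arg
    rw [this]
    exact norm_pos_iff.2 hz0
  · simp [rotL_apply, rotTrans]
    rw [← hc, ← hs]
    ring

theorem contDiffOn_coord {f : ℝ → L3} {I : Set ℝ} (hf : ContDiffOn ℝ ∞ f I) (θ : ℝ) (i : Fin 3) :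
    ContDiffOn ℝ ∞ (fun v => rotL θ (f v) i) I :=
  contDiffOn_pi.1 ((rotL θ).contDiff.comp_contDiffOn hf) i

theorem contDiffOn_comp_snd {f : ℝ → ℝ} {I : Set ℝ} (hf : ContDiffOn ℝ ∞ f I) :
    ContDiffOn ℝ ∞ (fun q : ℝ × ℝ => f q.2) (Prod.snd ⁻¹' I) :=
  hf.comp contDiff_snd.contDiffOn fun _ h => h

/-- The direction is divided by its first coordinate and the base point slides along the ruling to
the plane `x₁ = 0`, so the new first parameter is the coordinate `x₁` itself. -/
theorem ruled_rotL {α β : ℝ → L3} {θ : ℝ} {q : ℝ × ℝ} (hb : rotL θ (β q.2) 0 ≠ 0) :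
    rotL θ (ruled α β q) = graphRuled
      (fun v => rotL θ (α v) 1 - rotL θ (α v) 0 * (rotL θ (β v) 1 / rotL θ (β v) 0))
      (fun v => rotL θ (β v) 1 / rotL θ (β v) 0)
      (fun v => rotL θ (β v) 2 / rotL θ (β v) 0)
      (fun v => rotL θ (α v) 2 - rotL θ (α v) 0 * (rotL θ (β v) 2 / rotL θ (β v) 0))
      (rotL θ (α q.2) 0 + q.1 * rotL θ (β q.2) 0, q.2) := by
  rw [ruled, map_add, map_smul]
  funext i
  fin_cases i
  · simp [graphRuled]
  · simp [graphRuled]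
    field_simp
    ring
  · simp [graphRuled]
    field_simp
    ring

theorem contDiffOn_normalGaussMap {x N : ℝ × ℝ → L3} {D : Set (ℝ × ℝ)}
    (hx : IsSpacelikeImmersion x D) (hN : ContDiffOn ℝ ∞ N D) :
    ContDiffOn ℝ ∞ (normalGaussMap x N) D := by
  have : normalGaussMap x N = fun q => (x q 2)⁻¹ • N q := funext (normalGaussMap_eq x N)
  rw [this]
  exact ((contDiffOn_pi.1 hx.smooth 2).inv fun q hq => (hx.mapsTo hq : 0 < x q 2).ne').smul hN

theorem mink_smul_smul (c d : ℝ) (X Y : L3) : mink (c • X) (d • Y) = c * d * mink X Y := by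
  simp only [mink, Pi.smul_apply, smul_eq_mul]
  ring

theorem IsSpacelikeImmersion.mink_pos {x : ℝ × ℝ → L3} {D : Set (ℝ × ℝ)}
    (hx : IsSpacelikeImmersion x D) {q : ℝ × ℝ} (hq : q ∈ D) {w : ℝ × ℝ} (hw : w ≠ 0) :
    0 < mink (fderiv ℝ x q w) (fderiv ℝ x q w) := by
  have h := hx.pos q hq w hw
  have hp : 0 < x q 2 := hx.mapsTo hq
  rw [metric] at h
  exact (div_pos_iff_of_pos_right (by positivity)).1 h

/-- A ruled surface with conformal normal Gauss map is, after a rotation and a change of the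
parameter of the rulings, locally a conformal graph. -/
theorem exists_isConformalGraph {D : Set (ℝ × ℝ)} (hD : IsOpen D) {α β : ℝ → L3}
    (hα : ContDiffOn ℝ ∞ α (Prod.snd '' D)) (hβ : ContDiffOn ℝ ∞ β (Prod.snd '' D))
    (hx : IsSpacelikeImmersion (ruled α β) D)
    (hconf : HasConformalNormalGaussMap (ruled α β) D) {p : ℝ × ℝ} (hp : p ∈ D) :
    ∃ (θ : ℝ) (A I : Set ℝ) (a y g h l b : ℝ → ℝ), IsConformalGraph A I a y g h ∧
      ContDiffOn ℝ ∞ l I ∧ ContDiffOn ℝ ∞ b I ∧ y p.2 = 0 ∧ p.2 ∈ I ∧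
      l p.2 + p.1 * b p.2 ∈ A ∧ ∀ q : ℝ × ℝ, q.2 ∈ I → l q.2 + q.1 * b q.2 ∈ A →
        q ∈ D ∧ rotL θ (ruled α β q) = graphRuled a y g h (l q.2 + q.1 * b q.2, q.2) := by
  have hsnd : IsOpen (Prod.snd '' D) := isOpenMap_snd D hD
  have hpv : p.2 ∈ Prod.snd '' D := ⟨p, hp, rfl⟩
  have hβ0 : 0 < mink (β p.2) (β p.2) := by
    have h1 := hx.mink_pos hp (w := (1, 0)) (by simp)
    have hd : DifferentiableAt ℝ (ruled α β) p :=
      (hx.smooth.contDiffAt (hD.mem_nhds hp)).differentiableAt (by simp)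
    have hc : HasDerivAt (fun u : ℝ => ruled α β (u, p.2)) (fderiv ℝ (ruled α β) p (1, 0)) p.1 :=
      HasFDerivAt.comp_hasDerivAt (f := fun u : ℝ => (u, p.2)) p.1 hd.hasFDerivAt
        ((hasDerivAt_id p.1).prodMk (hasDerivAt_const p.1 p.2))
    have hc' : HasDerivAt (fun u : ℝ => ruled α β (u, p.2)) (β p.2) p.1 := by
      have := ((hasDerivAt_id p.1).smul_const (β p.2)).const_add (α p.2)
      simpa [ruled] using this
    rwa [hc.unique hc'] at h1
  obtain ⟨θ, hθ0, hθ1⟩ := exists_rotL hβ0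
  obtain ⟨N, hN, ρ, -, hρ⟩ := hconf
  have cα := contDiffOn_coord hα θ
  have cβ := contDiffOn_coord hβ θ
  -- On these rulings the rotated direction keeps a positive first coordinate, so `Φ` below and its
  -- inverse `Ψ` pass between the given parameters and those of the graph.
  set V : Set ℝ := Prod.snd '' D ∩ (fun v => rotL θ (β v) 0) ⁻¹' Set.Ioi 0 with hV
  have hVo : IsOpen V := (cβ 0).continuousOn.isOpen_inter_preimage hsnd isOpen_Ioi
  have hVs : V ⊆ Prod.snd '' D := Set.inter_subset_left
  have hVb : ∀ v ∈ V, rotL θ (β v) 0 ≠ 0 := fun v hv => ne_of_gt hv.2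
  have cα' := fun i => (cα i).mono hVs
  have cβ' := fun i => (cβ i).mono hVs
  set l : ℝ → ℝ := fun v => rotL θ (α v) 0 with hl
  set b : ℝ → ℝ := fun v => rotL θ (β v) 0 with hb
  set y : ℝ → ℝ := fun v => rotL θ (β v) 1 / rotL θ (β v) 0 with hy
  set g : ℝ → ℝ := fun v => rotL θ (β v) 2 / rotL θ (β v) 0 with hg
  set a : ℝ → ℝ := fun v => rotL θ (α v) 1
    - rotL θ (α v) 0 * (rotL θ (β v) 1 / rotL θ (β v) 0) with ha
  set h : ℝ → ℝ := fun v => rotL θ (α v) 2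
    - rotL θ (α v) 0 * (rotL θ (β v) 2 / rotL θ (β v) 0) with hh
  have cy : ContDiffOn ℝ ∞ y V := (cβ' 1).div (cβ' 0) hVb
  have cg : ContDiffOn ℝ ∞ g V := (cβ' 2).div (cβ' 0) hVb
  have ca : ContDiffOn ℝ ∞ a V := (cα' 1).sub ((cα' 0).mul cy)
  have ch : ContDiffOn ℝ ∞ h V := (cα' 2).sub ((cα' 0).mul cg)
  set Φ : ℝ × ℝ → ℝ × ℝ := fun q => (l q.2 + q.1 * b q.2, q.2) with hΦ
  set Ψ : ℝ × ℝ → ℝ × ℝ := fun q => ((q.1 - l q.2) / b q.2, q.2) with hΨ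
  have hVo' : IsOpen (Prod.snd ⁻¹' V : Set (ℝ × ℝ)) := hVo.preimage continuous_snd
  have cΨ : ContDiffOn ℝ ∞ Ψ (Prod.snd ⁻¹' V) :=
    ((contDiff_fst.contDiffOn.sub (contDiffOn_comp_snd (cα' 0))).div
      (contDiffOn_comp_snd (cβ' 0)) fun q hq => hVb _ hq).prodMk contDiff_snd.contDiffOn
  have cΦ : ContDiffOn ℝ ∞ Φ (Prod.snd ⁻¹' V) :=
    ((contDiffOn_comp_snd (cα' 0)).add (contDiff_fst.contDiffOn.mul
      (contDiffOn_comp_snd (cβ' 0)))).prodMk contDiff_snd.contDiffOn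
  have hΦΨ : ∀ q : ℝ × ℝ, q.2 ∈ V → Φ (Ψ q) = q := by
    intro q hq
    have := hVb _ hq
    refine Prod.ext ?_ rfl
    change l q.2 + (q.1 - l q.2) / b q.2 * b q.2 = q.1
    rw [div_mul_cancel₀ _ this]
    ring
  have hΨΦ : ∀ q : ℝ × ℝ, q.2 ∈ V → Ψ (Φ q) = q := by
    intro q hq
    have := hVb _ hq
    refine Prod.ext ?_ rfl
    change (l q.2 + q.1 * b q.2 - l q.2) / b q.2 = q.1
    rw [add_sub_cancel_left, mul_div_cancel_right₀ _ this]
  have hgr : ∀ q : ℝ × ℝ, q.2 ∈ V → rotL θ (ruled α β q) = graphRuled a y g h (Φ q) :=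
    fun q hq => ruled_rotL (hVb _ hq)
  have hgr' : ∀ q : ℝ × ℝ, q.2 ∈ V → graphRuled a y g h q = rotL θ (ruled α β (Ψ q)) := by
    intro q hq
    rw [hgr (Ψ q) hq, hΦΨ q hq]
  set Ω : Set (ℝ × ℝ) := Prod.snd ⁻¹' V ∩ Ψ ⁻¹' D with hΩ
  have hΩo : IsOpen Ω := cΨ.continuousOn.isOpen_inter_preimage hVo' hD
  have hpV : p.2 ∈ V := ⟨hpv, hθ0⟩
  have hpΩ : Φ p ∈ Ω := by
    refine ⟨hpV, ?_⟩
    change Ψ (Φ p) ∈ D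
    rwa [hΨΦ p hpV]
  have dΨ : ∀ q ∈ Ω, HasFDerivAt Ψ (fderiv ℝ Ψ q) q := fun q hq =>
    ((cΨ.contDiffAt (hVo'.mem_nhds hq.1)).differentiableAt (by simp)).hasFDerivAt
  have dx : ∀ q ∈ D, HasFDerivAt (ruled α β) (fderiv ℝ (ruled α β) q) q := fun q hq =>
    ((hx.smooth.contDiffAt (hD.mem_nhds hq)).differentiableAt (by simp)).hasFDerivAt
  have cG := contDiffOn_normalGaussMap hx hN.smooth
  have dG : ∀ q ∈ D, HasFDerivAt (normalGaussMap (ruled α β) N)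
      (fderiv ℝ (normalGaussMap (ruled α β) N) q) q := fun q hq =>
    ((cG.contDiffAt (hD.mem_nhds hq)).differentiableAt (by simp)).hasFDerivAt
  have dN : ∀ q ∈ D, DifferentiableAt ℝ N q := fun q hq =>
    (hN.smooth.contDiffAt (hD.mem_nhds hq)).differentiableAt (by simp)
  have hΨ0 : ∀ q ∈ Ω, ∀ w, w ≠ 0 → fderiv ℝ Ψ q w ≠ 0 := by
    intro q hq w hw h0
    apply hw
    have h1 : HasFDerivAt (Φ ∘ Ψ) ((fderiv ℝ Φ (Ψ q)).comp (fderiv ℝ Ψ q)) q :=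
      ((cΦ.contDiffAt (hVo'.mem_nhds (show Ψ q ∈ Prod.snd ⁻¹' V from hq.1))).differentiableAt
        (by simp)).hasFDerivAt.comp q (dΨ q hq)
    have h2 := h1.unique ((hasFDerivAt_id q).congr_of_eventuallyEq
      (Filter.eventually_of_mem (hVo'.mem_nhds hq.1) hΦΨ))
    have h3 := DFunLike.congr_fun h2 w
    simpa [h0] using h3.symm
  have fgr : ∀ q ∈ Ω, ∀ w, fderiv ℝ (graphRuled a y g h) q w
      = rotL θ (fderiv ℝ (ruled α β) (Ψ q) (fderiv ℝ Ψ q w)) := by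
    intro q hq w
    have h1 : HasFDerivAt (graphRuled a y g h)
        ((rotL θ).comp ((fderiv ℝ (ruled α β) (Ψ q)).comp (fderiv ℝ Ψ q))) q :=
      ((rotL θ).hasFDerivAt.comp q ((dx _ hq.2).comp q (dΨ q hq))).congr_of_eventuallyEq
        (Filter.eventually_of_mem (hVo'.mem_nhds hq.1) hgr')
    rw [h1.fderiv]
    rfl
  set n : ℝ × ℝ → L3 := fun q => rotL θ (normalGaussMap (ruled α β) N (Ψ q)) with hn
  have dn : ∀ q ∈ Ω, HasFDerivAt n ((rotL θ).comp
      ((fderiv ℝ (normalGaussMap (ruled α β) N) (Ψ q)).comp (fderiv ℝ Ψ q))) q := fun q hq =>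
    (rotL θ).hasFDerivAt.comp q ((dG _ hq.2).comp q (dΨ q hq))
  have fn : ∀ q ∈ Ω, ∀ w, fderiv ℝ n q w
      = rotL θ (fderiv ℝ (normalGaussMap (ruled α β) N) (Ψ q) (fderiv ℝ Ψ q w)) := by
    intro q hq w
    rw [(dn q hq).fderiv]
    rfl
  have hx2 : ∀ q ∈ Ω, graphRuled a y g h q 2 = ruled α β (Ψ q) 2 := by
    intro q hq
    rw [hgr' q hq.1]
    rfl
  have hpos2 : ∀ q ∈ Ω, 0 < ruled α β (Ψ q) 2 := fun q hq => hx.mapsTo hq.2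
  have hmN : ∀ q ∈ D, ∀ w, mink (N q) (fderiv ℝ (ruled α β) q w) = 0 := by
    intro q hq w
    have h1 := hN.normal q hq w
    have h2 : 0 < ruled α β q 2 := hx.mapsTo hq
    rw [metric] at h1
    exact (div_eq_zero_iff.1 h1).resolve_right (pow_ne_zero 2 h2.ne')
  have hsp : ∀ q ∈ Ω, ∀ w : ℝ × ℝ, w ≠ 0 →
      0 < mink (fderiv ℝ (graphRuled a y g h) q w) (fderiv ℝ (graphRuled a y g h) q w) := by
    intro q hq w hw
    rw [fgr q hq, mink_rotL]
    exact hx.mink_pos hq.2 (hΨ0 q hq w hw)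
  have heq : ∀ {u v : ℝ}, (u, v) ∈ Ω → _ := fun huv =>
    graphRuled_equation (Ω := Ω) (n := n) (ρ := fun q => ρ (Ψ q)) hΩo hVo (fun q hq => hq.1)
      ca cy cg ch (fun q hq => (dn q hq).differentiableAt.differentiableWithinAt)
      (fun q hq => by
        rw [hx2 q hq]
        exact (hpos2 q hq).ne') hsp
      (fun q hq => by
        have h1 := hN.unit _ hq.2
        rw [metric] at h1
        rw [hn, mink_rotL, normalGaussMap_eq, mink_smul_smul, ← h1]
        have := (hpos2 q hq).ne'
        field_simp)
      (fun q hq w => by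
        rw [hn, fgr q hq, mink_rotL, normalGaussMap_eq,
          ← one_smul ℝ (fderiv ℝ (ruled α β) (Ψ q) _), mink_smul_smul, hmN _ hq.2, mul_zero])
      (fun q hq w w' => by
        rw [fn q hq, fn q hq, fgr q hq, fgr q hq]
        simp only [mink_rotL]
        have h1 := hρ _ hq.2 (fderiv ℝ Ψ q w) (fderiv ℝ Ψ q w')
        rw [fourthForm, secondForm_eq (hpos2 q hq) (hmN _ hq.2) (dx _ hq.2).differentiableAt
          (dN _ hq.2)] at h1
        rw [h1, hx2 q hq]
        rfl) huv
  -- A product neighbourhood gives every ruling over `I` the same open set `A` of parameters, as the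
  -- polynomial argument requires.
  obtain ⟨A, I, hAo, hIo, hpA, hpI, hAI⟩ := isOpen_prod_iff.1 hΩo (Φ p).1 (Φ p).2 hpΩ
  have hIV : I ⊆ V := fun v hv => (hAI (Set.mk_mem_prod hpA hv)).1
  refine ⟨θ, A, I, a, y, g, h, l, b, ⟨hAo, hIo, ca.mono hIV, cy.mono hIV, cg.mono hIV, ch.mono hIV,
    ?_, ?_, ?_⟩, (cα' 0).mono hIV, (cβ' 0).mono hIV, ?_, hpI, hpA, ?_⟩
  · intro u hu v hv
    have hq := hAI (Set.mk_mem_prod hu hv)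
    have := hpos2 _ hq
    rw [← hx2 _ hq] at this
    exact this
  · intro u hu v hv s t hst
    have hq := hAI (Set.mk_mem_prod hu hv)
    have := hsp _ hq (s, t) hst
    have D1 := fun {f : ℝ → ℝ} (hf : ContDiffOn ℝ ∞ f V) =>
      (hf.contDiffAt (hVo.mem_nhds (hIV hv))).differentiableAt (by simp)
    rw [fderiv_graphRuled (D1 ca) (D1 cy) (D1 cg) (D1 ch)] at this
    simp [mink] at this
    linarith
  · intro u hu v hv
    exact heq (hAI (Set.mk_mem_prod hu hv))
  · simp [hy, hθ1]
  · intro q hqI hqA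
    have hq : Φ q ∈ Ω := hAI (Set.mk_mem_prod hqA hqI)
    have h1 : Ψ (Φ q) ∈ D := hq.2
    rw [hΨΦ q (hIV hqI)] at h1
    exact ⟨h1, hgr q (hIV hqI)⟩

/-! ### The model surfaces and the classification -/

theorem differentiable_plane (P A B : L3) : Differentiable ℝ (plane P A B) := by
  unfold plane
  fun_prop

theorem differentiable_surfaceThree (c₁ c₂ : ℝ) : Differentiable ℝ (surfaceThree c₁ c₂) := by
  rw [differentiable_pi]
  intro i
  fin_cases i <;> simp [surfaceThree] <;> fun_prop

theorem surfaceThree_zero (c : ℝ) : surfaceThree c 0 = surfaceTwo c := by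
  funext q i
  fin_cases i <;> simp [surfaceThree, surfaceTwo]

/-- The points of a graph whose parameters are affine functions of `a`, as points of
`surfaceThree`. -/
theorem surfaceThree_arsinh {u a g h k k₀ m m₀ : ℝ} (hg : 0 < 1 - g ^ 2) (hk : k ≠ 0)
    (hs : g / √(1 - g ^ 2) = k * a + k₀) (hh : h / √(1 - g ^ 2) = m * a + m₀) :
    ![u + m / k, a + k₀ / k, h + u * g] = surfaceThree (1 / k) (m₀ - m * k₀ / k)
      ((u + m / k - (m₀ - m * k₀ / k) * (k * a + k₀)) / √(1 + (k * a + k₀) ^ 2),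
        Real.arsinh (k * a + k₀)) := by
  have hw := Real.sqrt_pos.2 hg
  have hw2 := Real.sq_sqrt hg.le
  set w := √(1 - g ^ 2) with hwd
  set s := k * a + k₀ with hsd
  have hg' : g = s * w := by
    rw [← hs]
    field_simp
  have hh' : h = (m * a + m₀) * w := by
    rw [← hh]
    field_simp
  have h1 : w ^ 2 * (1 + s ^ 2) = 1 := by
    rw [hg'] at hw2
    linear_combination hw2
  -- With `s = sinh v` this says `w = 1 / cosh v` and `g = tanh v`.
  have hC : √(1 + s ^ 2) = 1 / w := by
    rw [Real.sqrt_eq_iff_mul_self_eq_of_pos (by positivity)]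
    field_simp
    linear_combination -h1
  have ha : a = (s - k₀) / k := by
    rw [hsd]
    field_simp
    ring
  have hw0 := hw.ne'
  funext i
  fin_cases i
  · simp [surfaceThree, Real.cosh_arsinh, hC]
    field_simp
    ring
  · simp [surfaceThree]
    rw [ha]
    field_simp
    ring
  · simp [surfaceThree, Real.cosh_arsinh, hC]
    rw [hh', hg', ha]
    field_simp
    linear_combination (m₀ * k - m * k₀) * h1

end DeSitter

theorem theorem6p2 (D : Set (ℝ × ℝ)) (hD : IsOpen D) (α β : ℝ → DeSitter.L3)
    (hα : ContDiffOn ℝ ∞ α (Prod.snd '' D)) (hβ : ContDiffOn ℝ ∞ β (Prod.snd '' D))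
    (hx : DeSitter.IsSpacelikeImmersion (DeSitter.ruled α β) D)
    (hconf : DeSitter.HasConformalNormalGaussMap (DeSitter.ruled α β) D)
    (p : ℝ × ℝ) (hp : p ∈ D) :
    ∃ θ a b : ℝ,
      (∃ P A B : DeSitter.L3, DeSitter.SpanSpacelike A B ∧
        DeSitter.IsPartOfNear (DeSitter.rotTrans θ a b ∘ DeSitter.ruled α β) D p
          (DeSitter.plane P A B)) ∨
      (∃ c : ℝ, c ≠ 0 ∧
        DeSitter.IsPartOfNear (DeSitter.rotTrans θ a b ∘ DeSitter.ruled α β) D p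
          (DeSitter.surfaceTwo c)) ∨
      (∃ c₁ c₂ : ℝ, c₁ ≠ 0 ∧ c₂ ≠ 0 ∧
        DeSitter.IsPartOfNear (DeSitter.rotTrans θ a b ∘ DeSitter.ruled α β) D p
          (DeSitter.surfaceThree c₁ c₂)) := by
  open DeSitter in
  obtain ⟨θ, A, I, a, y, g, h, l, b, H, cl, cb, hyp, hpI, hpA, hgr⟩ :=
    exists_isConformalGraph hD hα hβ hx hconf hp
  have hA : A.Nonempty := ⟨_, hpA⟩
  have hinj : ∀ s t : ℝ, ∀ q ∈ D, ∀ w,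
      fderiv ℝ (rotTrans θ s t ∘ ruled α β) q w = 0 → w = 0 := by
    intro s t q hq w hw
    have dx := ((hx.smooth.contDiffAt (hD.mem_nhds hq)).differentiableAt (by simp)).hasFDerivAt
    have h1 : HasFDerivAt (rotTrans θ s t ∘ ruled α β)
        ((rotL θ).comp (fderiv ℝ (ruled α β) q)) q := by
      have : rotTrans θ s t ∘ ruled α β = fun q => rotL θ (ruled α β q) + ![s, t, 0] :=
        funext fun q => rotTrans_eq θ s t _
      rw [this]
      exact ((rotL θ).hasFDerivAt.comp q dx).add_const _
    rw [h1.fderiv, ContinuousLinearMap.comp_apply] at hw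
    by_contra hne
    have h2 := hx.mink_pos hq hne
    rw [← mink_rotL θ, hw] at h2
    simp [mink] at h2
  -- the neighbourhood of `p` over a smaller interval of rulings
  have hU : ∀ r > 0, Metric.ball p.2 r ⊆ I → ∃ U : Set (ℝ × ℝ), IsOpen U ∧ U ⊆ D ∧ p ∈ U ∧
      (∀ q ∈ U, q.2 ∈ Metric.ball p.2 r ∧
        rotL θ (ruled α β q) = graphRuled a y g h (l q.2 + q.1 * b q.2, q.2)) ∧
      ContDiffOn ℝ ∞ (fun q : ℝ × ℝ => l q.2 + q.1 * b q.2) U ∧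
      ∀ f : ℝ → ℝ, ContDiffOn ℝ ∞ f I → ContDiffOn ℝ ∞ (fun q : ℝ × ℝ => f q.2) U := by
    intro r hr hI
    have cU : ContDiffOn ℝ ∞ (fun q : ℝ × ℝ => l q.2 + q.1 * b q.2)
        (Prod.snd ⁻¹' Metric.ball p.2 r) :=
      (contDiffOn_comp_snd (cl.mono hI)).add
        (contDiff_fst.contDiffOn.mul (contDiffOn_comp_snd (cb.mono hI)))
    refine ⟨Prod.snd ⁻¹' Metric.ball p.2 r ∩ (fun q : ℝ × ℝ => l q.2 + q.1 * b q.2) ⁻¹' A,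
      cU.continuousOn.isOpen_inter_preimage (Metric.isOpen_ball.preimage continuous_snd)
        H.isOpen_fst, fun q hq => (hgr q (hI hq.1) hq.2).1, ⟨Metric.mem_ball_self hr, hpA⟩,
      fun q hq => ⟨hq.1, (hgr q (hI hq.1) hq.2).2⟩, cU.mono Set.inter_subset_left,
      fun f hf => (contDiffOn_comp_snd (hf.mono hI)).mono Set.inter_subset_left⟩
  by_cases h0 : deriv a p.2 * deriv g p.2 - deriv h p.2 * deriv y p.2 = 0
  · obtain ⟨r, hr, hrI, τ, s, c, hgh⟩ := H.exists_plane hA hpI h0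
    obtain ⟨U, hUo, hUD, hpU, hUx, cU, cf⟩ := hU r hr hrI
    -- The plane is `x₃ = c + s x₁ + τ x₂`, parametrized by `(x₁, x₂)`.
    refine ⟨θ, 0, 0, Or.inl ⟨![0, 0, c], ![1, 0, s], ![0, 1, τ], ?_,
      isPartOfNear_of_comp hUo hUD hpU
        (cU.prodMk ((cf a H.smooth_a).add (cU.mul (cf y H.smooth_y))))
        (differentiable_plane _ _ _) ?_ fun q hq => hinj 0 0 q (hUD hq)⟩⟩
    · intro k t hkt
      have hc := H.ne_zero hpA hpI
      set u := l p.2 + p.1 * b p.2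
      have hball := Metric.mem_ball_self (x := p.2) hr
      have hev : ∀ᶠ v in nhds p.2, g v = s + τ * y v ∧ h v = c + τ * a v :=
        Filter.eventually_of_mem (Metric.isOpen_ball.mem_nhds hball) hgh
      have hg1 : deriv g p.2 = τ * deriv y p.2 := by
        have e : g =ᶠ[nhds p.2] fun v => s + τ * y v := hev.mono fun _ hv => hv.1
        rw [e.deriv_eq, deriv_const_add, deriv_const_mul_field]
      have hh1 : deriv h p.2 = τ * deriv a p.2 := by
        have e : h =ᶠ[nhds p.2] fun v => c + τ * a v := hev.mono fun _ hv => hv.2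
        rw [e.deriv_eq, deriv_const_add, deriv_const_mul_field]
      -- These are the coefficients of `k (1, 0, s) + t (0, 1, τ)` in the tangent basis `x_u`, `x_v`
      -- at `p`, so space-likeness of the plane is that of the surface.
      have h1 := H.spacelike u hpA p.2 hpI k ((t - k * y p.2) / (deriv a p.2 + u * deriv y p.2))
        (by
          intro he
          obtain ⟨rfl, h2⟩ := Prod.mk.inj he
          rw [zero_mul, sub_zero, div_eq_zero_iff] at h2
          exact hkt (Prod.ext rfl (h2.resolve_right hc)))
      rw [hg1, hh1, (hgh _ hball).1] at h1
      have e1 : deriv h p.2 + u * deriv g p.2 = τ * (deriv a p.2 + u * deriv y p.2) := by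
        rw [hg1, hh1]; ring
      have e2 : (t - k * y p.2) / (deriv a p.2 + u * deriv y p.2)
          * (deriv a p.2 + u * deriv y p.2) = t - k * y p.2 := div_mul_cancel₀ _ hc
      have e3 : (t - k * y p.2) / (deriv a p.2 + u * deriv y p.2)
          * (τ * deriv a p.2 + u * (τ * deriv y p.2)) = τ * (t - k * y p.2) := by
        linear_combination τ * e2
      rw [e2, e3] at h1
      simp [mink]
      linarith
    · intro q hq
      obtain ⟨hqb, hqx⟩ := hUx q hq
      obtain ⟨e1, e2⟩ := hgh _ hqb
      rw [Function.comp_apply, ← rotL_apply, hqx]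
      funext i
      fin_cases i
      · simp [graphRuled, plane]
      · simp [graphRuled, plane]
      · simp [graphRuled, plane, e1, e2]
        ring
  · obtain ⟨r, hr, hrI, k, k₀, m, m₀, hk, hgh⟩ := H.exists_affine hA hpI hyp h0
    obtain ⟨U, hUo, hUD, hpU, hUx, cU, cf⟩ := hU r hr hrI
    have hpart : IsPartOfNear (rotTrans θ (m / k) (k₀ / k) ∘ ruled α β) D p
        (surfaceThree (1 / k) (m₀ - m * k₀ / k)) := by
      have cs : ContDiffOn ℝ ∞ (fun q : ℝ × ℝ => k * a q.2 + k₀) U :=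
        (contDiffOn_const.mul (cf a H.smooth_a)).add contDiffOn_const
      refine isPartOfNear_of_comp hUo hUD hpU
        (f := fun q => ((l q.2 + q.1 * b q.2 + m / k - (m₀ - m * k₀ / k) * (k * a q.2 + k₀))
          / √(1 + (k * a q.2 + k₀) ^ 2), Real.arsinh (k * a q.2 + k₀)))
        (ContDiffOn.prodMk (ContDiffOn.div ((cU.add contDiffOn_const).sub
          (contDiffOn_const.mul cs)) ((contDiffOn_const.add (cs.pow 2)).sqrt
          fun q _ => by positivity) fun q _ => by positivity)
          (Real.contDiff_arsinh.comp_contDiffOn cs))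
        (differentiable_surfaceThree _ _) ?_ fun q hq => hinj _ _ q (hUD hq)
      intro q hq
      obtain ⟨hqb, hqx⟩ := hUx q hq
      obtain ⟨hy0, hs, hh⟩ := hgh _ hqb
      have hE := H.normSq_pos hA (hrI hqb)
      rw [hy0] at hE
      rw [← surfaceThree_arsinh (by linarith) hk hs hh, Function.comp_apply, rotTrans_eq, hqx]
      funext i
      fin_cases i <;> simp [graphRuled, hy0]
    have hk' : 1 / k ≠ 0 := one_div_ne_zero hk
    by_cases hc : m₀ - m * k₀ / k = 0
    · rw [hc, surfaceThree_zero] at hpart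
      exact ⟨θ, _, _, Or.inr (Or.inl ⟨_, hk', hpart⟩)⟩
    · exact ⟨θ, _, _, Or.inr (Or.inr ⟨_, _, hk', hc, hpart⟩)⟩
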